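/- Let $d\ge 1$ and consider the infinite spin chain with sites $\mathbb{Z}$ and local space $\mathbb{C}^d$ at every site. Let $\mathcal{B}_0$ be the space of traceless $d\times d$ matrices. A formal operator is a family $\Phi=\sum_A\Phi(A)$ with $\Phi(A)\in\mathcal{B}_0^{\otimes A}$ for every finite $A\subset\mathbb{Z}$ (and $\mathcal{B}_0^{\otimes\emptyset}=\mathbb{C}$). It is at most $r$-local if $\Phi(A)=0$ whenever $A\neq\emptyset$ and $\max A-\min A+1>r$, local if it is at most $r$-local for some $r$, and translation-invariant if each $\Phi(A+1)$ is the translate of $\Phi(A)$. For $\Phi$ local, $[\Phi,\Psi](A)$ is the component in $\mathcal{B}_0^{\otimes A}$ of $[\Phi|_B,\Psi|_B]$, where $\Phi|_B=\sum_{A'\subseteq B}\Phi(A')$ and $B\supseteq A$ is any sufficiently large finite set; $\Psi$ is a conserved quantity of $\Phi$ if $[\Phi,\Psi]=0$. Let $U\subseteq\mathbb{R}^D$ be open and $v:U\to\mathbb{R}^D$ smooth. For $\lambda\in U$ let $$H(\lambda)=\sum_{i\in\mathbb{Z}}h^{(2)}_i(\lambda)+\sum_{i\in\mathbb{Z}}h^{(1)}_i(\lambda),\qquad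 h^{(2)}_i(\lambda)\in\mathcal{B}_0^{\otimes\{i,i+1\}},\quad h^{(1)}_i(\lambda)\in\mathcal{B}_0^{\otimes\{i\}},$$ be a Hermitian, translation-invariant nearest-neighbour Hamiltonian that depends smoothly on $\lambda$, and let $C(\lambda)$ be a translation-invariant, at most one-local formal operator that depends smoothly on $\lambda$. Put $B_{H(\lambda)}=\sum_{j\in\mathbb{Z}}j\,\bigl(h^{(2)}_j(\lambda)+h^{(1)}_j(\lambda)\bigr)+C(\lambda)$ and define, for $\lambda\in U$, $$Q^{(2)}(\lambda)=H(\lambda),\qquad Q^{(n+1)}(\lambda)=[B_{H(\lambda)},Q^{(n)}(\lambda)]+(v\cdot\nabla)Q^{(n)}(\lambda)\quad(n\ge 2),$$ where $v\cdot\nabla=\sum_{a=1}^D v_a\,\partial_{\lambda_a}$ acts on each component. If $Q^{(3)}(\lambda)$ is a conserved quantity of $H(\lambda)$ for every $\lambda\in U$ (the generalized Reshetikhin condition), then for every $n\ge 2$ the operators $Q^{(n)}(\lambda)$ are well-defined, at most $n$-local and smooth in $\lambda$, and $Q^{(n)}(\lambda)$ is a translation-invariant conserved quantity of $H(\lambda)$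 for every $\lambda\in U$. Moreover $[Q^{(m)}(\lambda),Q^{(n)}(\lambda)]=0$ for all $m,n\ge 2$ and $\lambda\in U$. -/

import Mathlib

open scoped ContDiff

namespace SpinChain

/-- Operators on `(ℂ^d)^{⊗A}` for a finite set `A ⊂ ℤ` of sites, as matrices in the product
basis, which is indexed by the spin configurations `A → Fin d`. -/
abbrev Op (d : ℕ) (A : Finset ℤ) : Type := Matrix (A → Fin d) (A → Fin d) ℂ

/-- `X` lies in `𝓑₀^{⊗A}`: its partial trace over each single site of `A` vanishes
(no condition for `A = ∅`). -/
def IsTracelessOp {d : ℕ} {A : Finset ℤ} (X : Op d A) : Prop :=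
  ∀ (i : A) (s t : A → Fin d),
    ∑ k : Fin d, X (Function.update s i k) (Function.update t i k) = 0

/-- The embedding `X ↦ X ⊗ I_{B∖A}` of operators on `A` into operators on `B ⊇ A`. -/
def embed {d : ℕ} {A B : Finset ℤ} (h : A ⊆ B) (X : Op d A) : Op d B := fun s t =>
  if ∀ i : B, (i : ℤ) ∉ A → s i = t i then
    X (Finset.restrict₂ (π := fun _ => Fin d) h s) (Finset.restrict₂ (π := fun _ => Fin d) h t)
  else 0

/-- The configuration on `B` equal to `s` on `A` and to `u` on `B ∖ A`. -/
def glue {d : ℕ} {A B : Finset ℤ} (s : A → Fin d) (u : ↥(B \ A) → Fin d) : B → Fin d :=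
  fun i => if hi : (i : ℤ) ∈ A then s ⟨i, hi⟩ else u ⟨i, Finset.mem_sdiff.2 ⟨i.2, hi⟩⟩

/-- The normalized partial trace `d^{-|B∖A|} Tr_{B∖A}` from operators on `B` to operators
on `A` (used for `A ⊆ B`). -/
noncomputable def partialTrace {d : ℕ} {A B : Finset ℤ} (Y : Op d B) : Op d A := fun s t =>
  ((d : ℂ) ^ (B \ A).card)⁻¹ * ∑ u : ↥(B \ A) → Fin d, Y (glue s u) (glue t u)

/-- The component `Y_A ∈ 𝓑₀^{⊗A}` of `Y ∈ 𝓑^{⊗B} = ⨁_{A ⊆ B} 𝓑₀^{⊗A}` (used for `A ⊆ B`), by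
inclusion-exclusion over `C ⊆ A`. -/
noncomputable def component {d : ℕ} {B : Finset ℤ} (A : Finset ℤ) (Y : Op d B) : Op d A :=
  ∑ C ∈ A.powerset.attach,
    (-1 : ℂ) ^ (A \ C.1).card •
      embed (Finset.mem_powerset.1 C.2) (partialTrace (A := C.1) Y)

/-- Families `A ↦ Φ(A)` of operators indexed by the finite subsets of `ℤ`; the formal operators
on the infinite chain are those with `IsTraceless`. -/
abbrev FormalOp (d : ℕ) : Type := (A : Finset ℤ) → Op d A

/-- `Φ(A) ∈ 𝓑₀^{⊗A}` for all `A`. -/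
def IsTraceless {d : ℕ} (Φ : FormalOp d) : Prop := ∀ A, IsTracelessOp (Φ A)

/-- `Φ† = Φ`. -/
def IsSelfAdj {d : ℕ} (Φ : FormalOp d) : Prop := ∀ A, (Φ A).IsHermitian

/-- The range `max A - min A + 1` of a finite set, `0` for the empty set. -/
noncomputable def setRange (A : Finset ℤ) : ℕ :=
  if h : A.Nonempty then (A.max' h - A.min' h + 1).toNat else 0

/-- The range of a formal operator, `sup {r(A) | Φ(A) ≠ 0}`. The operator is at most `r`-local
when this is at most `r`, and local when it is finite. -/
noncomputable def opRange {d : ℕ} (Φ : FormalOp d) : ℕ∞ :=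
  ⨆ (A : Finset ℤ) (_ : Φ A ≠ 0), (setRange A : ℕ∞)

/-- The translate `A + 1`. -/
def shift (A : Finset ℤ) : Finset ℤ := A.map (addRightEmbedding (1 : ℤ))

theorem sub_one_mem {A : Finset ℤ} (i : shift A) : (i : ℤ) - 1 ∈ A := by
  obtain ⟨i, hi⟩ := i
  simp only [shift, Finset.mem_map, addRightEmbedding_apply] at hi
  obtain ⟨a, ha, rfl⟩ := hi
  simpa using ha

/-- The spin configuration on `A + 1` obtained by translating one on `A`. -/
def shiftConfig {d : ℕ} {A : Finset ℤ} (s : A → Fin d) : shift A → Fin d :=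
  fun i => s ⟨(i : ℤ) - 1, sub_one_mem i⟩

/-- The translation superoperator `(𝒯 Φ)(A) = τ_A(1)† Φ(A + 1) τ_A(1)`. -/
def translate {d : ℕ} (Φ : FormalOp d) : FormalOp d :=
  fun A => (Φ (shift A)).submatrix shiftConfig shiftConfig

/-- `𝒯 Φ = Φ`. -/
def IsTranslationInvariant {d : ℕ} (Φ : FormalOp d) : Prop := translate Φ = Φ

/-- The restriction `Φ|_B = ∑_{A ⊆ B} Φ(A)`, an operator on `B`. -/
def restrictTo {d : ℕ} (Φ : FormalOp d) (B : Finset ℤ) : Op d B :=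
  ∑ A ∈ B.powerset.attach, embed (Finset.mem_powerset.1 A.2) (Φ A.1)

/-- The set of sites at distance at most `r` from `A`. -/
noncomputable def thicken (r : ℕ) (A : Finset ℤ) : Finset ℤ :=
  A.biUnion fun i => Finset.Icc (i - r) (i + r)

/-- The commutator of a local formal operator `Φ` with a formal operator `Ψ`:
`[Φ, Ψ](A) = [Φ|_B, Ψ|_B]_A` for any sufficiently large finite set `B`. The set `B` of all sites
within distance `r(Φ)` of `A` is large enough: a term `[Φ(C), Ψ(C')]` has a nonzero
component on `A` only if `C` meets `A` and `C' ⊆ C ∪ A`. -/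
noncomputable def comm {d : ℕ} (Φ Ψ : FormalOp d) : FormalOp d := fun A =>
  component A
    (restrictTo Φ (thicken (opRange Φ).toNat A) * restrictTo Ψ (thicken (opRange Φ).toNat A) -
      restrictTo Ψ (thicken (opRange Φ).toNat A) * restrictTo Φ (thicken (opRange Φ).toNat A))

/-- `Ψ` is a conserved quantity of `Φ`. -/
def IsConserved {d : ℕ} (Φ Ψ : FormalOp d) : Prop := comm Φ Ψ = 0

/-- `Φ = ∑ᵢ h²ᵢ + ∑ᵢ h¹ᵢ` consists of on-site terms `h¹ᵢ = Φ({i})` and nearest-neighbour terms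
`h²ᵢ = Φ({i, i+1})` only. -/
def IsNearestNeighbor {d : ℕ} (Φ : FormalOp d) : Prop :=
  ∀ A : Finset ℤ, Φ A ≠ 0 → ∃ i : ℤ, A = {i} ∨ A = {i, i + 1}

/-- The leftmost site of a nonempty `A`. -/
def leftmost (A : Finset ℤ) : ℤ := if h : A.Nonempty then A.min' h else 0

/-- The boost operator `∑ⱼ j (h²ⱼ + h¹ⱼ) + C` of a nearest-neighbour `H = ∑ⱼ h²ⱼ + ∑ⱼ h¹ⱼ`. -/
noncomputable def boost {d : ℕ} (H C : FormalOp d) : FormalOp d :=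
  fun A => (leftmost A : ℂ) • H A + C A

/-- A family of formal operators depends smoothly on the parameter in `U`
(all matrix entries of all components do). -/
def IsSmoothOn {d D : ℕ} (U : Set (EuclideanSpace ℝ (Fin D)))
    (Φ : EuclideanSpace ℝ (Fin D) → FormalOp d) : Prop :=
  ∀ (A : Finset ℤ) (s t : A → Fin d), ContDiffOn ℝ ∞ (fun p => Φ p A s t) U

/-- The derivative `(v · ∇) Φ` of a family of formal operators along the vector field `v`. -/
noncomputable def dirDeriv {d D : ℕ}
    (v : EuclideanSpace ℝ (Fin D) → EuclideanSpace ℝ (Fin D))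
    (Φ : EuclideanSpace ℝ (Fin D) → FormalOp d) :
    EuclideanSpace ℝ (Fin D) → FormalOp d :=
  fun p A => Matrix.of fun s t => fderiv ℝ (fun q => Φ q A s t) p (v p)

/-- The operators `Q⁽ⁿ⁾`: `Q⁽²⁾ = H` and `Q⁽ⁿ⁺¹⁾ = [𝔅_H, Q⁽ⁿ⁾] + (v · ∇) Q⁽ⁿ⁾` for `n ≥ 2`
(the values at `n = 0, 1` are not used). -/
noncomputable def charge {d D : ℕ}
    (v : EuclideanSpace ℝ (Fin D) → EuclideanSpace ℝ (Fin D))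
    (H C : EuclideanSpace ℝ (Fin D) → FormalOp d) :
    ℕ → EuclideanSpace ℝ (Fin D) → FormalOp d
  | 0 => 0
  | 1 => 0
  | 2 => H
  | n + 3 => fun p =>
      comm (boost (H p) (C p)) (charge v H C (n + 2) p) + dirDeriv v (charge v H C (n + 2)) p

end SpinChain

/-! The maps `δ = [B_H, ·] + v · ∇` and `[H, ·]` are derivations of the commutator. If `[H, Q] = 0`
for all parameters, applying `δ` gives `[H, δQ] = -[δH, Q]`, and since the Reshetikhin condition
`[H, δH] = 0` makes `[H, ·]` annihilate the right-hand side, `[H, [H, δQ]] = 0`. Moreover `δQ` is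
translation-invariant, because translating `B_H` changes it by `H`, which commutes with `Q`. On
translation-invariant local operators the trace per site `⟨K, Q⟩ = τ(K† Q)` is an inner product
for which `[H, ·]` is symmetric when `H` is self-adjoint, so
`‖[H, δQ]‖² = ⟨δQ, [H, [H, δQ]]⟩ = 0`. Hence `δ` preserves conservation, and
`[δQ, Q'] + [Q, δQ'] = 0` propagates commutation from `H` to all charges. -/

namespace SpinChain

section PartialTrace

open scoped Kronecker

variable {d : ℕ} {A B C S : Finset ℤ}

/-- Configurations on `B` as pairs of a configuration on `A` and one on `B \ A`; the inverse
is `glue`. -/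
def splitEquiv (d : ℕ) (h : A ⊆ B) : (B → Fin d) ≃ (A → Fin d) × (↥(B \ A) → Fin d) where
  toFun s := (fun i => s ⟨i, h i.2⟩, fun i => s ⟨i, Finset.sdiff_subset i.2⟩)
  invFun p := glue p.1 p.2
  left_inv s := by
    funext i
    by_cases hi : (i : ℤ) ∈ A <;> simp [glue, hi]
  right_inv p := by
    refine Prod.ext (funext fun i => ?_) (funext fun i => ?_)
    · simp [glue]
    · simp [glue, (Finset.mem_sdiff.1 i.2).2]

theorem embed_eq_kronecker (h : A ⊆ B) (X : Op d A) :
    embed h X = (X ⊗ₖ (1 : Op d (B \ A))).submatrix (splitEquiv d h) (splitEquiv d h) := by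
  ext s t
  have hst : (∀ i : B, (i : ℤ) ∉ A → s i = t i) ↔ (splitEquiv d h s).2 = (splitEquiv d h t).2 :=
    ⟨fun H => funext fun i => H _ (Finset.mem_sdiff.1 i.2).2,
      fun H i hi => congrFun H ⟨i, Finset.mem_sdiff.2 ⟨i.2, hi⟩⟩⟩
  simp only [embed, hst, Matrix.submatrix_apply, Matrix.kroneckerMap_apply, Matrix.one_apply,
    mul_ite, mul_one, mul_zero]
  rfl

theorem embed_sdiff_eq_kronecker (h : A ⊆ B) (Z : Op d (B \ A)) :
    embed Finset.sdiff_subset Z =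
      ((1 : Op d A) ⊗ₖ Z).submatrix (splitEquiv d h) (splitEquiv d h) := by
  ext s t
  have hst : (∀ i : B, (i : ℤ) ∉ B \ A → s i = t i) ↔
      (splitEquiv d h s).1 = (splitEquiv d h t).1 :=
    ⟨fun H => funext fun i => H ⟨i, h i.2⟩ fun hi => (Finset.mem_sdiff.1 hi).2 i.2,
      fun H i hi => congrFun H ⟨i, by simpa using hi⟩⟩
  simp only [embed, hst, Matrix.submatrix_apply, Matrix.kroneckerMap_apply, Matrix.one_apply,
    ite_mul, one_mul, zero_mul]
  rfl

theorem embed_embed (h : A ⊆ B) (h' : B ⊆ C) (X : Op d A) :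
    embed h' (embed h X) = embed (h.trans h') X := by
  ext s t
  simp only [embed, ← ite_and]
  refine if_congr ⟨fun H i hi => ?_, fun H => ⟨fun i hi => H i fun hA => hi (h hA),
    fun i hi => H ⟨i, h' i.2⟩ hi⟩⟩ rfl rfl
  by_cases hB : (i : ℤ) ∈ B
  exacts [H.2 ⟨i, hB⟩ hi, H.1 i hB]

/-- The inclusion of the operators on `A` into those on `B ⊇ A` as a homomorphism of
star-algebras; the junk value `0` unless `A ⊆ B` keeps sums of embedded operators free of subset
proofs. -/
noncomputable def embedHom (B : Finset ℤ) : Op d A →⋆ₙₐ[ℂ] Op d B :=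
  if h : A ⊆ B then
    { toFun := embed h
      map_smul' := fun c X => by
        simp only [embed_eq_kronecker, Matrix.smul_kronecker]; rfl
      map_zero' := by simp only [embed_eq_kronecker, Matrix.zero_kronecker]; rfl
      map_add' := fun X Y => by simp only [embed_eq_kronecker, Matrix.add_kronecker]; rfl
      map_mul' := fun X Y => by
        simp only [embed_eq_kronecker, Matrix.submatrix_mul_equiv, ← Matrix.mul_kronecker_mul,
          mul_one]
      map_star' := fun X => by
        simp only [embed_eq_kronecker, Matrix.star_eq_conjTranspose,
          Matrix.conjTranspose_submatrix, Matrix.conjTranspose_kronecker,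
          Matrix.conjTranspose_one] }
  else 0

theorem embedHom_of_subset (h : A ⊆ B) (X : Op d A) : embedHom B X = embed h X := by
  simp only [embedHom, dif_pos h]; rfl

theorem embedHom_self (X : Op d A) : embedHom A X = X := by
  ext s t
  rw [embedHom_of_subset subset_rfl]
  exact if_pos fun i hi => absurd i.2 hi

theorem embedHom_embedHom (h : A ⊆ B) (h' : B ⊆ C) (X : Op d A) :
    embedHom C (embedHom B X) = embedHom C X := by
  rw [embedHom_of_subset h, embedHom_of_subset h', embedHom_of_subset (h.trans h'), embed_embed]

theorem commute_embedHom (hA : A ⊆ B) (hC : C ⊆ B) (h : Disjoint A C) (X : Op d A)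
    (Y : Op d C) : Commute (embedHom B X) (embedHom B Y) := by
  have hCA : C ⊆ B \ A := Finset.subset_sdiff.2 ⟨hC, h.symm⟩
  rw [← embedHom_embedHom hCA Finset.sdiff_subset, embedHom_of_subset hA,
    embedHom_of_subset Finset.sdiff_subset, embed_eq_kronecker, embed_sdiff_eq_kronecker hA,
    commute_iff_eq, Matrix.submatrix_mul_equiv, Matrix.submatrix_mul_equiv,
    ← Matrix.mul_kronecker_mul, ← Matrix.mul_kronecker_mul]
  simp only [mul_one, one_mul]

/-- The normalized trace, which takes the value `1` at the identity and is compatible with the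
embeddings `embedHom`. -/
noncomputable def ntr : Op d A →ₗ[ℂ] ℂ := ((d : ℂ) ^ A.card)⁻¹ • Matrix.traceLinearMap _ ℂ ℂ

theorem ntr_mul_comm (X Y : Op d A) : ntr (X * Y) = ntr (Y * X) := by
  simp only [ntr, LinearMap.smul_apply, Matrix.traceLinearMap_apply, Matrix.trace_mul_comm X Y]

theorem ntr_star (X : Op d A) : ntr (star X) = star (ntr X) := by
  simp only [ntr, LinearMap.smul_apply, Matrix.traceLinearMap_apply, Matrix.star_eq_conjTranspose,
    Matrix.trace_conjTranspose, star_smul, star_inv₀, star_pow, star_natCast]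

/-- `partialTrace` as a linear map. -/
noncomputable def partialTraceₗ (A : Finset ℤ) : Op d B →ₗ[ℂ] Op d A where
  toFun := partialTrace
  map_add' X Y := by ext; simp [partialTrace, Finset.sum_add_distrib, mul_add]
  map_smul' c X := by ext; simp [partialTrace, ← Finset.mul_sum, mul_left_comm]

theorem ntr_embedHom_mul (h : A ⊆ B) (X : Op d A) (Y : Op d B) :
    ntr (embedHom B X * Y) = ntr (X * partialTraceₗ A Y) := by
  have hcard : (d : ℂ) ^ B.card = d ^ A.card * d ^ (B \ A).card := by
    rw [← pow_add, Finset.card_sdiff_of_subset h, Nat.add_sub_of_le (Finset.card_le_card h)]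
  have key : (embedHom B X * Y).trace = ∑ a, ∑ b, X a b * ∑ u, Y (glue b u) (glue a u) := by
    simp only [embedHom_of_subset h, embed_eq_kronecker, Matrix.trace, Matrix.diag_apply,
      Matrix.mul_apply, Matrix.submatrix_apply]
    rw [← (splitEquiv d h).symm.sum_comp, Fintype.sum_prod_type]
    refine Finset.sum_congr rfl fun a _ => ?_
    simp_rw [← (splitEquiv d h).symm.sum_comp (fun t => _ * Y t _), Fintype.sum_prod_type]
    rw [Finset.sum_comm]
    refine Finset.sum_congr rfl fun b _ => ?_
    simp only [Matrix.kroneckerMap_apply, Equiv.apply_symm_apply, Matrix.one_apply, mul_ite,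
      mul_one, mul_zero, ite_mul, zero_mul, Finset.sum_ite_eq, Finset.mem_univ, if_true,
      Finset.mul_sum]
    rfl
  simp only [ntr, LinearMap.smul_apply, Matrix.traceLinearMap_apply, key, hcard, mul_inv,
    smul_eq_mul, mul_assoc]
  congr 1
  simp only [Matrix.trace, Matrix.diag_apply, Matrix.mul_apply, Finset.mul_sum, partialTraceₗ,
    partialTrace, LinearMap.coe_mk, AddHom.coe_mk, mul_left_comm]

variable [NeZero d]

theorem ext_ntr_mul {X Y : Op d A} (h : ∀ Z : Op d A, ntr (Z * X) = ntr (Z * Y)) : X = Y :=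
  Matrix.ext_iff_trace_mul_left.2 fun Z =>
    mul_left_cancel₀ (inv_ne_zero (pow_ne_zero _ (Nat.cast_ne_zero.2 (NeZero.ne d)))) (h Z)

theorem partialTraceₗ_partialTraceₗ (h : A ⊆ B) (h' : B ⊆ C) (Y : Op d C) :
    partialTraceₗ A (partialTraceₗ B Y) = partialTraceₗ A Y := by
  refine ext_ntr_mul fun Z => ?_
  rw [← ntr_embedHom_mul h, ← ntr_embedHom_mul h', embedHom_embedHom h h',
    ← ntr_embedHom_mul (h.trans h')]

theorem partialTraceₗ_embedHom_mul (h : A ⊆ B) (X : Op d A) (Y : Op d B) :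
    partialTraceₗ A (embedHom B X * Y) = X * partialTraceₗ A Y := by
  refine ext_ntr_mul fun Z => ?_
  rw [← ntr_embedHom_mul h, ← mul_assoc, ← map_mul, ntr_embedHom_mul h, mul_assoc]

theorem partialTraceₗ_mul_comm (hS : S ⊆ B) (hA : A ⊆ B) (h : Disjoint S A) (X : Op d S)
    (Y : Op d B) :
    partialTraceₗ A (embedHom B X * Y) = partialTraceₗ A (Y * embedHom B X) := by
  refine ext_ntr_mul fun Z => ?_
  rw [← ntr_embedHom_mul hA, ← ntr_embedHom_mul hA, ← mul_assoc, ← mul_assoc,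
    ntr_mul_comm _ (embedHom B X), ← mul_assoc, (commute_embedHom hS hA h X Z).eq]

theorem partialTraceₗ_mul_embedHom (h : A ⊆ B) (X : Op d A) (Y : Op d B) :
    partialTraceₗ A (Y * embedHom B X) = partialTraceₗ A Y * X := by
  refine ext_ntr_mul fun Z => ?_
  rw [← ntr_embedHom_mul h, ← mul_assoc, ntr_mul_comm, ← mul_assoc, ← map_mul,
    ntr_embedHom_mul h, mul_assoc, ntr_mul_comm, mul_assoc]

theorem partialTraceₗ_one (h : A ⊆ B) : partialTraceₗ A (1 : Op d B) = 1 := by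
  have hd : (d : ℂ) ^ (B \ A).card ≠ 0 := pow_ne_zero _ (Nat.cast_ne_zero.2 (NeZero.ne d))
  ext s t
  have hst (u : ↥(B \ A) → Fin d) : glue s u = (glue t u : B → Fin d) ↔ s = t := by
    change (splitEquiv d h).symm (s, u) = (splitEquiv d h).symm (t, u) ↔ _
    simp
  simp only [partialTraceₗ, LinearMap.coe_mk, AddHom.coe_mk, partialTrace, Matrix.one_apply, hst]
  split_ifs <;> simp [hd]

theorem partialTraceₗ_embedHom_self (h : A ⊆ B) (X : Op d A) :
    partialTraceₗ A (embedHom B X) = X := by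
  rw [← mul_one (embedHom B X), partialTraceₗ_embedHom_mul h, partialTraceₗ_one h, mul_one]

theorem partialTraceₗ_self (X : Op d A) : partialTraceₗ A X = X := by
  simpa only [embedHom_self] using partialTraceₗ_embedHom_self subset_rfl X

theorem partialTraceₗ_embedHom (hA : A ⊆ B) (hC : C ⊆ B) (X : Op d A) :
    partialTraceₗ C (embedHom B X) = embedHom C (partialTraceₗ (A ∩ C) X) := by
  have hAC : A ⊆ A ∪ C := Finset.subset_union_left
  have hCA : C ⊆ A ∪ C := Finset.subset_union_right
  have hsd : (A ∪ C) \ C = A \ (A ∩ C) := by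
    rw [Finset.union_sdiff_right, Finset.sdiff_inter_self_left]
  rw [← embedHom_embedHom hAC (Finset.union_subset hA hC),
    ← partialTraceₗ_partialTraceₗ hCA (Finset.union_subset hA hC),
    partialTraceₗ_embedHom_self (Finset.union_subset hA hC), embedHom_of_subset hAC,
    embedHom_of_subset Finset.inter_subset_right]
  ext s t
  have hst (u : ↥((A ∪ C) \ C) → Fin d) :
      (∀ i : ↥(A ∪ C), (i : ℤ) ∉ A → glue s u i = glue t u i) ↔
        ∀ i : C, (i : ℤ) ∉ A ∩ C → s i = t i := by
    refine ⟨fun H i hi => ?_, fun H i hi => ?_⟩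
    · simpa [glue] using H ⟨i, hCA i.2⟩ (by simpa using hi)
    · have hiC : (i : ℤ) ∈ C := (Finset.mem_union.1 i.2).resolve_left hi
      simpa [glue, hiC] using H ⟨i, hiC⟩ (by simp [hi])
  simp only [partialTraceₗ, LinearMap.coe_mk, AddHom.coe_mk, partialTrace, embed, hst]
  split_ifs
  · congr 1
    · rw [hsd]
    refine Fintype.sum_equiv ((Equiv.subtypeEquivRight fun i => by rw [hsd]).arrowCongr
      (Equiv.refl _)) _ _ fun u => ?_
    congr 1 <;>
    · funext i
      by_cases hi : (i : ℤ) ∈ C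
      · simp [glue, hi]
      · simp only [Finset.restrict₂_def, glue, hi, dite_false, Finset.mem_inter, and_false]
        rfl
  · simp

end PartialTrace

section Components

variable {d : ℕ} {A B C S T : Finset ℤ}

theorem IsTracelessOp.add {X Y : Op d A} (hX : IsTracelessOp X) (hY : IsTracelessOp Y) :
    IsTracelessOp (X + Y) := fun i s t => by
  simp only [Matrix.add_apply, Finset.sum_add_distrib, hX i s t, hY i s t, add_zero]

theorem IsTracelessOp.smul {X : Op d A} (hX : IsTracelessOp X) (c : ℂ) :
    IsTracelessOp (c • X) := fun i s t => by
  simp only [Matrix.smul_apply, ← Finset.smul_sum, hX i s t, smul_zero]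

theorem IsTracelessOp.star {X : Op d A} (hX : IsTracelessOp X) : IsTracelessOp (star X) :=
  fun i s t => by
    simpa only [star_sum, star_zero, Matrix.star_apply] using congrArg Star.star (hX i t s)

theorem partialTraceₗ_erase_apply (X : Op d A) (i : A) (s t : A → Fin d) :
    partialTraceₗ (A.erase (i : ℤ)) X
        (Finset.restrict₂ (π := fun _ => Fin d) (A.erase_subset (i : ℤ)) s)
        (Finset.restrict₂ (π := fun _ => Fin d) (A.erase_subset (i : ℤ)) t) =
      (d : ℂ)⁻¹ * ∑ k, X (Function.update s i k) (Function.update t i k) := by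
  have hsd : A \ A.erase i = {(i : ℤ)} := Finset.sdiff_erase_self i.2
  have hi : (i : ℤ) ∈ A \ A.erase i := hsd ▸ Finset.mem_singleton_self _
  let _ : Unique ↥(A \ A.erase i) :=
    ⟨⟨⟨i, hi⟩⟩, fun x => Subtype.ext (Finset.mem_singleton.1 (hsd ▸ x.2))⟩
  have hglue (s : A → Fin d) (u : ↥(A \ A.erase i) → Fin d) :
      glue (Finset.restrict₂ (π := fun _ => Fin d) (A.erase_subset (i : ℤ)) s) u =
        Function.update s i (Equiv.funUnique _ _ u) := by
    funext j
    obtain rfl | hj := eq_or_ne j i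
    · simp [glue]; rfl
    · simp [glue, hj]
  simp only [partialTraceₗ, LinearMap.coe_mk, AddHom.coe_mk, partialTrace, hglue, hsd,
    Finset.card_singleton, pow_one]
  congr 1
  exact (Equiv.funUnique _ _).sum_comp fun k => X (Function.update s i k) (Function.update t i k)

section Moebius

variable {M : Type*} [AddCommGroup M] [Module ℂ M]

theorem sum_powerset_neg_one_pow_sdiff_erase {i : ℤ} (hi : i ∈ A) (f : Finset ℤ → M)
    (hf : ∀ C, f C = f (C.erase i)) : ∑ C ∈ A.powerset, (-1 : ℂ) ^ (A \ C).card • f C = 0 := by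
  obtain ⟨A', hA', rfl⟩ : ∃ A', i ∉ A' ∧ insert i A' = A :=
    ⟨A.erase i, Finset.notMem_erase i A, Finset.insert_erase hi⟩
  rw [Finset.sum_powerset_insert hA', ← Finset.sum_add_distrib]
  refine Finset.sum_eq_zero fun C hC => ?_
  have hiC : i ∉ C := fun h => hA' (Finset.mem_powerset.1 hC h)
  rw [hf (insert i C), Finset.erase_insert hiC, Finset.insert_sdiff_of_notMem _ hiC,
    Finset.card_insert_of_notMem (fun h => hA' (Finset.mem_sdiff.1 h).1),
    Finset.insert_sdiff_insert, Finset.sdiff_insert_of_notMem hA', pow_succ, ← add_smul,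
    mul_neg_one, neg_add_cancel, zero_smul]

theorem sum_powerset_sum_powerset_neg_one_pow_sdiff (B : Finset ℤ) (f : Finset ℤ → M) :
    ∑ A ∈ B.powerset, ∑ C ∈ A.powerset, (-1 : ℂ) ^ (A \ C).card • f C = f B := by
  induction B using Finset.induction_on generalizing f with
  | empty => simp
  | insert i B hi ih =>
    rw [Finset.sum_powerset_insert hi, ← Finset.sum_add_distrib, ← ih fun C => f (insert i C)]
    refine Finset.sum_congr rfl fun A hA => ?_
    have hiA : i ∉ A := fun h => hi (Finset.mem_powerset.1 hA h)
    rw [Finset.sum_powerset_insert hiA, ← add_assoc, ← Finset.sum_add_distrib]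
    have hcancel : ∑ C ∈ A.powerset, ((-1 : ℂ) ^ (A \ C).card • f C +
        (-1 : ℂ) ^ (insert i A \ C).card • f C) = 0 := by
      refine Finset.sum_eq_zero fun C hC => ?_
      have hiC : i ∉ C := fun h => hiA (Finset.mem_powerset.1 hC h)
      rw [Finset.insert_sdiff_of_notMem _ hiC,
        Finset.card_insert_of_notMem (fun h => hiA (Finset.mem_sdiff.1 h).1), pow_succ,
        ← add_smul, mul_neg_one, add_neg_cancel, zero_smul]
    rw [hcancel, zero_add]
    refine Finset.sum_congr rfl fun C _ => ?_
    rw [Finset.insert_sdiff_insert, Finset.sdiff_insert_of_notMem hiA]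

end Moebius

theorem component_eq_sum (A : Finset ℤ) (Y : Op d B) :
    component A Y =
      ∑ C ∈ A.powerset, (-1 : ℂ) ^ (A \ C).card • embedHom A (partialTraceₗ C Y) := by
  rw [component, ← Finset.sum_attach A.powerset]
  refine Finset.sum_congr rfl fun C _ => ?_
  rw [embedHom_of_subset (Finset.mem_powerset.1 C.2)]
  rfl

/-- `component` as a linear map. -/
noncomputable def componentₗ (A : Finset ℤ) : Op d B →ₗ[ℂ] Op d A where
  toFun := component A
  map_add' X Y := by
    simp only [component_eq_sum, map_add, smul_add, Finset.sum_add_distrib]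
  map_smul' c X := by
    simp only [component_eq_sum, map_smul, Finset.smul_sum, smul_comm c, RingHom.id_apply]

theorem componentₗ_apply (A : Finset ℤ) (Y : Op d B) :
    componentₗ A Y =
      ∑ C ∈ A.powerset, (-1 : ℂ) ^ (A \ C).card • embedHom A (partialTraceₗ C Y) :=
  component_eq_sum A Y

variable [NeZero d]

theorem isTracelessOp_iff {X : Op d A} :
    IsTracelessOp X ↔ ∀ i ∈ A, partialTraceₗ (A.erase i) X = 0 := by
  have hd : (d : ℂ)⁻¹ ≠ 0 := inv_ne_zero (Nat.cast_ne_zero.2 (NeZero.ne d))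
  refine ⟨fun hX i hi => ?_, fun hX i s t => ?_⟩
  · have hsurj : Function.Surjective (Finset.restrict₂ (π := fun _ => Fin d) (A.erase_subset i)) :=
      Prod.fst_surjective.comp (splitEquiv d (A.erase_subset i)).surjective
    ext s t
    obtain ⟨s, rfl⟩ := hsurj s
    obtain ⟨t, rfl⟩ := hsurj t
    rw [partialTraceₗ_erase_apply X ⟨i, hi⟩, hX ⟨i, hi⟩, mul_zero, Matrix.zero_apply]
  · have := partialTraceₗ_erase_apply X i s t
    rw [hX i i.2, Matrix.zero_apply, eq_comm, mul_eq_zero] at this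
    exact this.resolve_left hd

theorem IsTracelessOp.partialTraceₗ_eq_zero {X : Op d A} (hX : IsTracelessOp X) (h : C ⊂ A) :
    partialTraceₗ C X = 0 := by
  obtain ⟨i, hi, hiC⟩ := Finset.exists_of_ssubset h
  rw [← partialTraceₗ_partialTraceₗ (Finset.subset_erase.2 ⟨h.1, hiC⟩) (A.erase_subset i),
    isTracelessOp_iff.1 hX i hi, map_zero]

theorem isTracelessOp_componentₗ (h : A ⊆ B) (Y : Op d B) : IsTracelessOp (componentₗ A Y) := by
  refine isTracelessOp_iff.2 fun i hi => ?_
  simp only [componentₗ_apply, map_sum, map_smul]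
  rw [← sum_powerset_neg_one_pow_sdiff_erase hi
    fun C => embedHom (A.erase i) (partialTraceₗ (C ∩ A.erase i) Y)]
  · refine Finset.sum_congr rfl fun C hC => ?_
    have hCA := Finset.mem_powerset.1 hC
    rw [partialTraceₗ_embedHom hCA (A.erase_subset i),
      partialTraceₗ_partialTraceₗ Finset.inter_subset_left (hCA.trans h)]
  · intro C
    rw [Finset.erase_inter, Finset.inter_erase, Finset.erase_idem]

theorem sum_embedHom_componentₗ (Y : Op d B) :
    ∑ A ∈ B.powerset, embedHom B (componentₗ A Y) = Y := by
  calc ∑ A ∈ B.powerset, embedHom B (componentₗ A Y)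
      = ∑ A ∈ B.powerset, ∑ C ∈ A.powerset,
          (-1 : ℂ) ^ (A \ C).card • embedHom B (partialTraceₗ C Y) := by
        refine Finset.sum_congr rfl fun A hA => ?_
        rw [componentₗ_apply, map_sum]
        refine Finset.sum_congr rfl fun C hC => ?_
        rw [map_smul, embedHom_embedHom (Finset.mem_powerset.1 hC) (Finset.mem_powerset.1 hA)]
    _ = embedHom B (partialTraceₗ B Y) :=
        sum_powerset_sum_powerset_neg_one_pow_sdiff B fun C => embedHom B (partialTraceₗ C Y)
    _ = Y := by rw [embedHom_self, partialTraceₗ_self]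

theorem componentₗ_partialTraceₗ (hA : A ⊆ T) (h : T ⊆ B) (Y : Op d B) :
    componentₗ A (partialTraceₗ T Y) = componentₗ A Y := by
  simp only [componentₗ_apply]
  refine Finset.sum_congr rfl fun C hC => ?_
  rw [partialTraceₗ_partialTraceₗ ((Finset.mem_powerset.1 hC).trans hA) h]

theorem componentₗ_mul_comm_of_disjoint (hA : A ⊆ B) (hS : S ⊆ B) (h : Disjoint S A)
    (X : Op d S) (Y : Op d B) :
    componentₗ A (embedHom B X * Y) = componentₗ A (Y * embedHom B X) := by
  rw [← componentₗ_partialTraceₗ subset_rfl hA, partialTraceₗ_mul_comm hS hA h,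
    componentₗ_partialTraceₗ subset_rfl hA]

theorem componentₗ_embedHom_of_not_subset (hS : S ⊆ B) (hA : A ⊆ B) (h : ¬A ⊆ S) (X : Op d S) :
    componentₗ A (embedHom B X) = 0 := by
  obtain ⟨i, hi, hiS⟩ := Finset.not_subset.1 h
  rw [componentₗ_apply, ← sum_powerset_neg_one_pow_sdiff_erase hi
    fun C => embedHom A (partialTraceₗ (S ∩ C) X)]
  · refine Finset.sum_congr rfl fun C hC => ?_
    have hCA := Finset.mem_powerset.1 hC
    rw [partialTraceₗ_embedHom hS (hCA.trans hA), embedHom_embedHom Finset.inter_subset_right hCA]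
  · intro C
    rw [Finset.inter_erase, ← Finset.erase_inter, Finset.erase_eq_of_notMem hiS]

theorem IsTracelessOp.componentₗ_self {X : Op d A} (hX : IsTracelessOp X) :
    componentₗ A X = X := by
  rw [componentₗ_apply, Finset.sum_eq_single_of_mem A (Finset.mem_powerset_self A)]
  · rw [Finset.sdiff_self, Finset.card_empty, pow_zero, one_smul, partialTraceₗ_self,
      embedHom_self]
  · intro C hC hne
    rw [hX.partialTraceₗ_eq_zero ((Finset.mem_powerset.1 hC).ssubset_of_ne hne), map_zero,
      smul_zero]

theorem IsTracelessOp.ntr_embedHom_mul {X : Op d A} (hX : IsTracelessOp X) (h : A ⊆ B)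
    (Y : Op d B) : ntr (embedHom B X * Y) = ntr (X * componentₗ A Y) := by
  rw [SpinChain.ntr_embedHom_mul h, componentₗ_apply, Finset.mul_sum, map_sum,
    Finset.sum_eq_single_of_mem A (Finset.mem_powerset_self A)]
  · rw [Finset.sdiff_self, Finset.card_empty, pow_zero, one_smul, embedHom_self]
  · intro C hC hne
    have hCA := Finset.mem_powerset.1 hC
    rw [mul_smul_comm, map_smul, ntr_mul_comm, SpinChain.ntr_embedHom_mul hCA,
      hX.partialTraceₗ_eq_zero (hCA.ssubset_of_ne hne), mul_zero, map_zero, smul_zero]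

end Components

section Commutators

attribute [local instance] LieRing.ofAssociativeRing

variable {d : ℕ} {A B C S T : Finset ℤ} {Φ Ψ Ω : FormalOp d} {r r₁ r₂ r₃ : ℕ}

theorem setRange_le_iff : setRange A ≤ r ↔ ∀ i ∈ A, ∀ j ∈ A, j - i < r := by
  rw [setRange]
  split_ifs with h
  · rw [Int.toNat_le]
    refine ⟨fun hr i hi j hj => ?_, fun hr => ?_⟩
    · have := A.min'_le i hi
      have := A.le_max' j hj
      omega
    · have := hr _ (A.min'_mem h) _ (A.max'_mem h)
      omega
  · simp [Finset.not_nonempty_iff_eq_empty.1 h]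

theorem opRange_le_iff : opRange Φ ≤ r ↔ ∀ A, Φ A ≠ 0 → ∀ i ∈ A, ∀ j ∈ A, j - i < r := by
  simp only [opRange, iSup₂_le_iff, Nat.cast_le, setRange_le_iff]

theorem opRange_add_le (hΦ : opRange Φ ≤ r) (hΨ : opRange Ψ ≤ r) : opRange (Φ + Ψ) ≤ r := by
  refine opRange_le_iff.2 fun A hA => ?_
  by_cases h : Φ A = 0
  · exact opRange_le_iff.1 hΨ A fun hΨA => hA (by rw [Pi.add_apply, h, hΨA, add_zero])
  · exact opRange_le_iff.1 hΦ A h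

theorem opRange_congr (h : ∀ A : Finset ℤ, A.Nonempty → Φ A = Ψ A) : opRange Φ = opRange Ψ := by
  refine iSup_congr fun A => ?_
  obtain rfl | hA := A.eq_empty_or_nonempty
  · simp [setRange]
  · rw [h A hA]

/-- The formal operators that are at most `r`-local. -/
structure IsLocal (r : ℕ) (Φ : FormalOp d) : Prop where
  traceless : IsTraceless Φ
  opRange_le : opRange Φ ≤ r

theorem IsLocal.mono (h : IsLocal r₁ Φ) (hr : r₁ ≤ r₂) : IsLocal r₂ Φ :=
  ⟨h.traceless, h.opRange_le.trans (Nat.cast_le.2 hr)⟩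

theorem IsTraceless.add (hΦ : IsTraceless Φ) (hΨ : IsTraceless Ψ) : IsTraceless (Φ + Ψ) :=
  fun A => (hΦ A).add (hΨ A)

theorem IsLocal.add (hΦ : IsLocal r Φ) (hΨ : IsLocal r Ψ) : IsLocal r (Φ + Ψ) :=
  ⟨hΦ.traceless.add hΨ.traceless, opRange_add_le hΦ.opRange_le hΨ.opRange_le⟩

theorem mem_thicken {x : ℤ} : x ∈ thicken r A ↔ ∃ i ∈ A, i - r ≤ x ∧ x ≤ i + r := by
  simp only [thicken, Finset.mem_biUnion, Finset.mem_Icc]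

theorem subset_thicken : A ⊆ thicken r A :=
  fun x hx => mem_thicken.2 ⟨x, hx, by omega, by omega⟩

theorem thicken_mono (h : r₁ ≤ r₂) : thicken r₁ A ⊆ thicken r₂ A := fun x hx => by
  obtain ⟨i, hi, hl, hu⟩ := mem_thicken.1 hx
  exact mem_thicken.2 ⟨i, hi, by omega, by omega⟩

theorem subset_thicken_of_not_disjoint (hC : ∀ i ∈ C, ∀ j ∈ C, j - i < r)
    (h : ¬Disjoint C A) : C ⊆ thicken r A := fun x hx => by
  obtain ⟨i, hiC, hiA⟩ := Finset.not_disjoint_iff.1 h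
  have := hC i hiC x hx
  have := hC x hx i hiC
  exact mem_thicken.2 ⟨i, hiA, by omega, by omega⟩

theorem thicken_thicken : thicken r₁ (thicken r₂ A) ⊆ thicken (r₁ + r₂) A := fun x hx => by
  obtain ⟨i, hi, hil, hiu⟩ := mem_thicken.1 hx
  obtain ⟨j, hj, hjl, hju⟩ := mem_thicken.1 hi
  exact mem_thicken.2 ⟨j, hj, by push_cast; omega, by push_cast; omega⟩

theorem thicken_subset_thicken (h : A ⊆ B) : thicken r A ⊆ thicken r B :=
  Finset.biUnion_subset_biUnion_of_subset_left _ h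

theorem restrictTo_eq_sum (Φ : FormalOp d) (B : Finset ℤ) :
    restrictTo Φ B = ∑ A ∈ B.powerset, embedHom B (Φ A) := by
  rw [restrictTo, ← Finset.sum_attach B.powerset]
  exact Finset.sum_congr rfl fun A _ => (embedHom_of_subset (Finset.mem_powerset.1 A.2) _).symm

theorem restrictTo_add (Φ Ψ : FormalOp d) :
    restrictTo (Φ + Ψ) B = restrictTo Φ B + restrictTo Ψ B := by
  simp only [restrictTo_eq_sum, Pi.add_apply, map_add, Finset.sum_add_distrib]

theorem comm_eq_componentₗ (Φ Ψ : FormalOp d) (A : Finset ℤ) :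
    comm Φ Ψ A = componentₗ A ⁅restrictTo Φ (thicken (opRange Φ).toNat A),
      restrictTo Ψ (thicken (opRange Φ).toNat A)⁆ := rfl

theorem comm_self (Φ : FormalOp d) : comm Φ Φ = 0 := by
  funext A
  rw [comm_eq_componentₗ, lie_self, map_zero, Pi.zero_apply]

theorem comm_zero_right (Φ : FormalOp d) : comm Φ 0 = 0 := by
  funext A
  simp only [comm_eq_componentₗ, restrictTo_eq_sum, Pi.zero_apply, map_zero,
    Finset.sum_const_zero, lie_zero]

theorem comm_zero_left (Φ : FormalOp d) : comm 0 Φ = 0 := by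
  funext A
  simp only [comm_eq_componentₗ, restrictTo_eq_sum, Pi.zero_apply, map_zero,
    Finset.sum_const_zero, zero_lie]

variable [NeZero d]

theorem partialTraceₗ_restrictTo (hΦ : IsTraceless Φ) (h : T ⊆ B) :
    partialTraceₗ T (restrictTo Φ B) = restrictTo Φ T := by
  rw [restrictTo_eq_sum, restrictTo_eq_sum, map_sum]
  symm
  refine Eq.trans (Finset.sum_congr rfl fun C hC => ?_)
    (Finset.sum_subset (Finset.powerset_mono.2 h) fun C hC hCT => ?_)
  · rw [← embedHom_embedHom (Finset.mem_powerset.1 hC) h, partialTraceₗ_embedHom_self h]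
  · have hinter : C ∩ T ⊂ C := Finset.inter_subset_left.ssubset_of_ne fun h' =>
      hCT (Finset.mem_powerset.2 (Finset.inter_eq_left.1 h'))
    rw [partialTraceₗ_embedHom (Finset.mem_powerset.1 hC) h, (hΦ C).partialTraceₗ_eq_zero hinter,
      map_zero]

theorem componentₗ_lie_of_disjoint (hA : A ⊆ B) (hS : S ⊆ B) (h : Disjoint S A) (X : Op d S)
    (Y : Op d B) : componentₗ A ⁅embedHom B X, Y⁆ = 0 := by
  rw [Ring.lie_def, map_sub, componentₗ_mul_comm_of_disjoint hA hS h, sub_self]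

theorem componentₗ_lie_embedHom (hA : A ⊆ T) (hT : T ⊆ B) (X : Op d T) (Y : Op d B) :
    componentₗ A ⁅embedHom B X, Y⁆ = componentₗ A ⁅X, partialTraceₗ T Y⁆ := by
  rw [← componentₗ_partialTraceₗ hA hT, Ring.lie_def, map_sub, partialTraceₗ_embedHom_mul hT,
    partialTraceₗ_mul_embedHom hT, Ring.lie_def]

theorem componentₗ_lie_sum_congr {f g : ∀ C : Finset ℤ, Op d C} (hA : A ⊆ B)
    (hfg : ∀ C ⊆ B, ¬Disjoint C A → f C = g C) (Y : Op d B) :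
    componentₗ A ⁅∑ C ∈ B.powerset, embedHom B (f C), Y⁆ =
      componentₗ A ⁅∑ C ∈ B.powerset, embedHom B (g C), Y⁆ := by
  simp only [sum_lie, map_sum]
  refine Finset.sum_congr rfl fun C hC => ?_
  have hCB := Finset.mem_powerset.1 hC
  by_cases hCA : Disjoint C A
  · rw [componentₗ_lie_of_disjoint hA hCB hCA, componentₗ_lie_of_disjoint hA hCB hCA]
  · rw [hfg C hCB hCA]

theorem comm_congr_left (h : ∀ A : Finset ℤ, A.Nonempty → Φ A = Ψ A) : comm Φ Ω = comm Ψ Ω := by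
  funext A
  rw [comm_eq_componentₗ, comm_eq_componentₗ, opRange_congr h, restrictTo_eq_sum Φ,
    restrictTo_eq_sum Ψ]
  refine componentₗ_lie_sum_congr subset_thicken (fun C _ hCA => h C ?_) _
  exact Finset.nonempty_iff_ne_empty.2 fun h0 => hCA (h0 ▸ Finset.disjoint_empty_left A)

theorem comm_apply (hΦ : opRange Φ ≤ r) (hΨ : IsTraceless Ψ) (hB : thicken r A ⊆ B) :
    comm Φ Ψ A = componentₗ A ⁅restrictTo Φ B, restrictTo Ψ B⁆ := by
  have hr : opRange Φ ≤ (opRange Φ).toNat :=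
    (ENat.natCast_toNat (ne_top_of_le_ne_top (ENat.natCast_ne_top r) hΦ)).ge
  rw [comm_eq_componentₗ]
  set T := thicken (opRange Φ).toNat A
  have hT : T ⊆ B := (thicken_mono (ENat.toNat_le_of_le_natCast hΦ)).trans hB
  rw [← partialTraceₗ_restrictTo hΨ hT, ← componentₗ_lie_embedHom subset_thicken hT]
  have hsum : embedHom B (restrictTo Φ T) =
      ∑ C ∈ B.powerset, embedHom B (if C ⊆ T then Φ C else 0) := by
    rw [restrictTo_eq_sum, map_sum, ← Finset.sum_subset (Finset.powerset_mono.2 hT)]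
    · refine Finset.sum_congr rfl fun C hC => ?_
      rw [if_pos (Finset.mem_powerset.1 hC), embedHom_embedHom (Finset.mem_powerset.1 hC) hT]
    · intro C _ hC
      rw [if_neg fun h => hC (Finset.mem_powerset.2 h), map_zero]
  rw [hsum, restrictTo_eq_sum Φ B]
  refine componentₗ_lie_sum_congr (subset_thicken.trans hT) (fun C _ hCA => ?_) _
  by_cases hC : Φ C = 0
  · rw [hC, ite_self]
  · exact if_pos (subset_thicken_of_not_disjoint (opRange_le_iff.1 hr C hC) hCA)

theorem exists_of_componentₗ_lie_restrictTo_ne_zero (hA : A ⊆ B)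
    (h : componentₗ A ⁅restrictTo Φ B, restrictTo Ψ B⁆ ≠ 0) :
    ∃ C E, Φ C ≠ 0 ∧ Ψ E ≠ 0 ∧ ¬Disjoint C E ∧ ¬Disjoint C A ∧ A ⊆ C ∪ E := by
  simp only [restrictTo_eq_sum, sum_lie, lie_sum, map_sum] at h
  obtain ⟨E, hE, h⟩ := Finset.exists_ne_zero_of_sum_ne_zero h
  obtain ⟨C, hC, h⟩ := Finset.exists_ne_zero_of_sum_ne_zero h
  rw [Finset.mem_powerset] at hC hE
  refine ⟨C, E, fun h0 => h ?_, fun h0 => h ?_, fun hCE => h ?_, fun hCA => h ?_, ?_⟩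
  · rw [h0, map_zero, zero_lie, map_zero]
  · rw [h0, map_zero, lie_zero, map_zero]
  · rw [(commute_embedHom hC hE hCE _ _).lie_eq, map_zero]
  · exact componentₗ_lie_of_disjoint hA hC hCA _ _
  · by_contra hsub
    have hCE := Finset.union_subset hC hE
    rw [← embedHom_embedHom Finset.subset_union_left hCE,
      ← embedHom_embedHom Finset.subset_union_right hCE, Ring.lie_def, ← map_mul, ← map_mul,
      ← map_sub] at h
    exact h (componentₗ_embedHom_of_not_subset hCE hA hsub _)

theorem exists_of_comm_apply_ne_zero (h : comm Φ Ψ A ≠ 0) :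
    ∃ C E, Φ C ≠ 0 ∧ Ψ E ≠ 0 ∧ ¬Disjoint C E ∧ ¬Disjoint C A ∧ A ⊆ C ∪ E :=
  exists_of_componentₗ_lie_restrictTo_ne_zero subset_thicken h

theorem comm_empty (Φ Ψ : FormalOp d) : comm Φ Ψ ∅ = 0 := by
  by_contra h
  obtain ⟨C, -, -, -, -, hC, -⟩ := exists_of_comm_apply_ne_zero h
  exact hC (Finset.disjoint_empty_right C)

theorem sub_lt_of_componentₗ_lie_restrictTo_ne_zero (hΦ : opRange Φ ≤ r₁)
    (hΨ : opRange Ψ ≤ r₂) (hA : A ⊆ B)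
    (h : componentₗ A ⁅restrictTo Φ B, restrictTo Ψ B⁆ ≠ 0) :
    ∀ i ∈ A, ∀ j ∈ A, j - i + 1 < r₁ + r₂ := by
  obtain ⟨C, E, hC, hE, hCE, -, hsub⟩ := exists_of_componentₗ_lie_restrictTo_ne_zero hA h
  obtain ⟨x, hxC, hxE⟩ := Finset.not_disjoint_iff.1 hCE
  have hCr := opRange_le_iff.1 hΦ C hC
  have hEr := opRange_le_iff.1 hΨ E hE
  intro i hi j hj
  have := hCr x hxC x hxC
  have := hEr x hxE x hxE
  obtain hi | hi := Finset.mem_union.1 (hsub hi) <;>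
    obtain hj | hj := Finset.mem_union.1 (hsub hj)
  · have := hCr i hi j hj
    omega
  · have := hCr i hi x hxC
    have := hEr x hxE j hj
    omega
  · have := hCr x hxC j hj
    have := hEr i hi x hxE
    omega
  · have := hEr i hi j hj
    omega

theorem isTraceless_comm (Φ Ψ : FormalOp d) : IsTraceless (comm Φ Ψ) :=
  fun _ => isTracelessOp_componentₗ subset_thicken _

theorem opRange_comm_le (hΦ : opRange Φ ≤ r₁) (hΨ : opRange Ψ ≤ r₂) (hr : r₁ + r₂ ≤ r + 1) :
    opRange (comm Φ Ψ) ≤ r := by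
  refine opRange_le_iff.2 fun A hA i hi j hj => ?_
  have := sub_lt_of_componentₗ_lie_restrictTo_ne_zero hΦ hΨ subset_thicken hA i hi j hj
  omega

theorem IsLocal.comm (hΦ : IsLocal r₁ Φ) (hΨ : IsLocal r₂ Ψ) (hr : r₁ + r₂ ≤ r + 1) :
    IsLocal r (comm Φ Ψ) :=
  ⟨isTraceless_comm Φ Ψ, opRange_comm_le hΦ.opRange_le hΨ.opRange_le hr⟩

theorem comm_swap (hΦ : IsLocal r₁ Φ) (hΨ : IsLocal r₂ Ψ) : comm Ψ Φ = -comm Φ Ψ := by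
  funext A
  rw [Pi.neg_apply,
    comm_apply hΦ.opRange_le hΨ.traceless (thicken_mono (Nat.le_add_right r₁ r₂)),
    comm_apply hΨ.opRange_le hΦ.traceless (thicken_mono (Nat.le_add_left r₂ r₁)), ← map_neg,
    lie_skew]

theorem comm_add_right (hΦ : opRange Φ ≤ r) (hΨ : IsTraceless Ψ) (hΩ : IsTraceless Ω) :
    comm Φ (Ψ + Ω) = comm Φ Ψ + comm Φ Ω := by
  funext A
  rw [Pi.add_apply, comm_apply hΦ (hΨ.add hΩ) subset_rfl, comm_apply hΦ hΨ subset_rfl,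
    comm_apply hΦ hΩ subset_rfl, restrictTo_add, lie_add, map_add]

theorem comm_add_left (hΦ : opRange Φ ≤ r) (hΨ : opRange Ψ ≤ r) (hΩ : IsTraceless Ω) :
    comm (Φ + Ψ) Ω = comm Φ Ω + comm Ψ Ω := by
  funext A
  rw [Pi.add_apply, comm_apply (opRange_add_le hΦ hΨ) hΩ subset_rfl,
    comm_apply hΦ hΩ subset_rfl, comm_apply hΨ hΩ subset_rfl, restrictTo_add, add_lie, map_add]

theorem comm_comm_apply (hΦ : opRange Φ ≤ r₁) (hΨ : IsLocal r₂ Ψ) (hΩ : IsTraceless Ω)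
    (hB : thicken (2 * (r₁ + r₂)) A ⊆ B) :
    comm (comm Φ Ψ) Ω A =
      componentₗ A ⁅⁅restrictTo Φ B, restrictTo Ψ B⁆, restrictTo Ω B⁆ := by
  have hloc := opRange_comm_le hΦ hΨ.opRange_le (Nat.le_succ (r₁ + r₂))
  rw [comm_apply hloc hΩ ((thicken_mono (by omega)).trans hB), restrictTo_eq_sum (comm Φ Ψ)]
  conv_rhs => rw [← sum_embedHom_componentₗ ⁅restrictTo Φ B, restrictTo Ψ B⁆]
  refine componentₗ_lie_sum_congr (subset_thicken.trans hB) (fun E hE hEA => ?_) _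
  by_cases hrange : ∀ i ∈ E, ∀ j ∈ E, j - i < (r₁ + r₂ : ℕ)
  · refine comm_apply hΦ hΨ.traceless (Finset.Subset.trans ?_ hB)
    exact (thicken_subset_thicken (subset_thicken_of_not_disjoint hrange hEA)).trans
      (thicken_thicken.trans (thicken_mono (by omega)))
  · have hcomm : comm Φ Ψ E = 0 := of_not_not fun h0 => hrange (opRange_le_iff.1 hloc E h0)
    have hcomp : componentₗ E ⁅restrictTo Φ B, restrictTo Ψ B⁆ = 0 :=
      of_not_not fun h0 => hrange fun i hi j hj => by
        have := sub_lt_of_componentₗ_lie_restrictTo_ne_zero hΦ hΨ.opRange_le hE h0 i hi j hj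
        omega
    rw [hcomm, hcomp]

theorem comm_jacobi (hΦ : IsLocal r₁ Φ) (hΨ : IsLocal r₂ Ψ) (hΩ : IsLocal r₃ Ω) :
    comm Φ (comm Ψ Ω) = comm (comm Φ Ψ) Ω + comm Ψ (comm Φ Ω) := by
  rw [comm_swap (hΨ.comm hΩ (Nat.le_succ _)) hΦ, comm_swap (hΦ.comm hΩ (Nat.le_succ _)) hΨ]
  funext A
  have hB {m : ℕ} (hm : m ≤ r₁ + r₂ + r₃) :
      thicken (2 * m) A ⊆ thicken (2 * (r₁ + r₂ + r₃)) A := thicken_mono (by omega)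
  rw [Pi.add_apply, Pi.neg_apply, Pi.neg_apply,
    comm_comm_apply hΦ.opRange_le hΨ hΩ.traceless (hB (by omega)),
    comm_comm_apply hΨ.opRange_le hΩ hΦ.traceless (hB (by omega)),
    comm_comm_apply hΦ.opRange_le hΩ hΨ.traceless (hB (by omega)), ← map_neg, ← map_neg,
    ← map_add, lie_skew, lie_skew, leibniz_lie]

end Commutators

section Translation

variable {d : ℕ} {A B C : Finset ℤ} {Φ Ψ : FormalOp d} {r : ℕ}

/-- The translate `A + k`. -/
def shiftBy (k : ℤ) (A : Finset ℤ) : Finset ℤ := A.map (addRightEmbedding k)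

theorem mem_shiftBy {k x : ℤ} : x ∈ shiftBy k A ↔ x - k ∈ A := by
  simp only [shiftBy, Finset.mem_map, addRightEmbedding_apply]
  exact ⟨by rintro ⟨a, ha, rfl⟩; simpa using ha, fun h => ⟨_, h, sub_add_cancel _ _⟩⟩

theorem mem_shift {x : ℤ} : x ∈ shift A ↔ x - 1 ∈ A := mem_shiftBy

theorem shiftBy_shiftBy (k l : ℤ) (A : Finset ℤ) :
    shiftBy k (shiftBy l A) = shiftBy (l + k) A := by
  ext x
  rw [mem_shiftBy, mem_shiftBy, mem_shiftBy, sub_sub, add_comm]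

theorem shiftBy_zero (A : Finset ℤ) : shiftBy 0 A = A := by
  ext x
  rw [mem_shiftBy, sub_zero]

theorem shift_shiftBy (k : ℤ) (A : Finset ℤ) : shift (shiftBy k A) = shiftBy (k + 1) A :=
  shiftBy_shiftBy 1 k A

theorem shift_injective : Function.Injective shift := Finset.map_injective _

theorem shift_surjective : Function.Surjective shift := fun A =>
  ⟨shiftBy (-1) A, by rw [shift_shiftBy, neg_add_cancel, shiftBy_zero]⟩

theorem shift_subset_shift : shift A ⊆ shift B ↔ A ⊆ B := Finset.map_subset_map

theorem shift_sdiff (A B : Finset ℤ) : shift (A \ B) = shift A \ shift B := Finset.map_sdiff _ _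

theorem sum_powerset_shift {M : Type*} [AddCommMonoid M] (A : Finset ℤ) (f : Finset ℤ → M) :
    ∑ C ∈ (shift A).powerset, f C = ∑ C ∈ A.powerset, f (shift C) := by
  refine (Finset.sum_nbij shift (fun C hC => ?_) shift_injective.injOn (fun C hC => ?_)
    fun C _ => rfl).symm
  · exact Finset.mem_powerset.2 (shift_subset_shift.2 (Finset.mem_powerset.1 hC))
  · obtain ⟨C, rfl⟩ := shift_surjective C
    exact ⟨C, Finset.mem_powerset.2 (shift_subset_shift.1 (Finset.mem_powerset.1 hC)), rfl⟩

theorem card_shift (A : Finset ℤ) : (shift A).card = A.card := Finset.card_map _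

theorem setRange_shift (A : Finset ℤ) : setRange (shift A) = setRange A :=
  eq_of_forall_ge_iff fun r => by
    simp only [setRange_le_iff, shift, Finset.forall_mem_map, addRightEmbedding_apply,
      add_sub_add_right_eq_sub]

theorem thicken_shift (r : ℕ) (A : Finset ℤ) : thicken r (shift A) = shift (thicken r A) := by
  ext x
  rw [mem_shift, mem_thicken, mem_thicken]
  constructor
  · rintro ⟨i, hi, hl, hu⟩
    exact ⟨i - 1, mem_shift.1 hi, by omega, by omega⟩
  · rintro ⟨i, hi, hl, hu⟩
    exact ⟨i + 1, mem_shift.2 (by simpa using hi), by omega, by omega⟩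

/-- Translation of configurations as an equivalence. -/
def shiftConfigEquiv (d : ℕ) (A : Finset ℤ) : (A → Fin d) ≃ (shift A → Fin d) where
  toFun := shiftConfig
  invFun s i := s ⟨i + 1, mem_shift.2 (by simp)⟩
  left_inv s := by funext i; simp [shiftConfig]
  right_inv s := by funext i; simp [shiftConfig]

/-- Translation of the operators on `A + 1` to operators on `A`. -/
def unshift : Op d (shift A) ≃ₐ[ℂ] Op d A :=
  Matrix.reindexAlgEquiv ℂ ℂ (shiftConfigEquiv d A).symm

theorem translate_apply (Φ : FormalOp d) (A : Finset ℤ) :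
    translate Φ A = unshift (Φ (shift A)) := rfl

theorem unshift_star (X : Op d (shift A)) : unshift (star X) = star (unshift X) := rfl

theorem ntr_unshift (X : Op d (shift A)) : ntr (unshift X) = ntr X := by
  simp only [ntr, LinearMap.smul_apply, Matrix.traceLinearMap_apply, card_shift]
  exact congrArg _ ((shiftConfigEquiv d A).sum_comp fun s => X s s)

theorem unshift_embedHom (X : Op d (shift A)) :
    unshift (embedHom (shift B) X) = embedHom B (unshift X) := by
  by_cases h : A ⊆ B
  · rw [embedHom_of_subset (shift_subset_shift.2 h), embedHom_of_subset h]
    ext s t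
    refine if_congr ⟨fun H i hi => ?_, fun H i hi => ?_⟩ rfl rfl
    · have hi' : (i : ℤ) + 1 ∉ shift A := fun h' => hi (by simpa using mem_shift.1 h')
      simpa [shiftConfigEquiv, shiftConfig] using H ⟨i + 1, mem_shift.2 (by simp)⟩ hi'
    · exact H ⟨(i : ℤ) - 1, sub_one_mem i⟩ fun h' => hi (mem_shift.2 h')
  · rw [embedHom, embedHom, dif_neg h, dif_neg (mt shift_subset_shift.1 h)]
    exact map_zero unshift

theorem translate_add (Φ Ψ : FormalOp d) : translate (Φ + Ψ) = translate Φ + translate Ψ := rfl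

theorem translate_single (C : Finset ℤ) (X : Op d (shift C)) :
    translate (Pi.single (shift C) X) = Pi.single C (unshift X) := by
  funext A
  rw [translate_apply]
  obtain rfl | hA := eq_or_ne A C
  · rw [Pi.single_eq_same, Pi.single_eq_same]
  · rw [Pi.single_eq_of_ne hA, Pi.single_eq_of_ne (shift_injective.ne hA), map_zero]

theorem opRange_translate (Φ : FormalOp d) : opRange (translate Φ) = opRange Φ :=
  shift_surjective.iSup_congr shift fun A => by
    rw [translate_apply, setRange_shift, map_ne_zero_iff _ unshift.injective]

theorem restrictTo_translate (Φ : FormalOp d) (B : Finset ℤ) :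
    restrictTo (translate Φ) B = unshift (restrictTo Φ (shift B)) := by
  simp only [restrictTo_eq_sum, sum_powerset_shift, map_sum, unshift_embedHom, translate_apply]

variable [NeZero d]

theorem unshift_partialTraceₗ (h : A ⊆ B) (Y : Op d (shift B)) :
    unshift (partialTraceₗ (shift A) Y) = partialTraceₗ A (unshift Y) := by
  refine ext_ntr_mul fun Z => ?_
  obtain ⟨Z, rfl⟩ := unshift.surjective Z
  rw [← map_mul, ntr_unshift, ← ntr_embedHom_mul (shift_subset_shift.2 h), ← ntr_embedHom_mul h,
    ← unshift_embedHom, ← map_mul, ntr_unshift]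

theorem unshift_componentₗ (h : A ⊆ B) (Y : Op d (shift B)) :
    unshift (componentₗ (shift A) Y) = componentₗ A (unshift Y) := by
  simp only [componentₗ_apply, sum_powerset_shift, map_sum, map_smul, unshift_embedHom]
  refine Finset.sum_congr rfl fun C hC => ?_
  have hCA := Finset.mem_powerset.1 hC
  rw [unshift_partialTraceₗ (hCA.trans h), ← card_shift (A \ C), shift_sdiff]

theorem translate_comm (Φ Ψ : FormalOp d) :
    translate (comm Φ Ψ) = comm (translate Φ) (translate Ψ) := by
  funext A
  rw [translate_apply, comm_eq_componentₗ, comm_eq_componentₗ, opRange_translate, thicken_shift,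
    unshift_componentₗ subset_thicken, restrictTo_translate, restrictTo_translate, Ring.lie_def,
    Ring.lie_def, map_sub, map_mul, map_mul]

theorem IsTranslationInvariant.comm (hΦ : IsTranslationInvariant Φ)
    (hΨ : IsTranslationInvariant Ψ) : IsTranslationInvariant (comm Φ Ψ) := by
  rw [IsTranslationInvariant, translate_comm, hΦ, hΨ]

end Translation

section TracePerSite

variable {d : ℕ} {A B C W : Finset ℤ} {Φ Ψ H K Q : FormalOp d} {r r₁ r₂ : ℕ}

theorem leftmost_mem (h : A.Nonempty) : leftmost A ∈ A := by
  rw [leftmost, dif_pos h]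
  exact A.min'_mem h

theorem leftmost_le {x : ℤ} (hx : x ∈ A) : leftmost A ≤ x := by
  rw [leftmost, dif_pos ⟨x, hx⟩]
  exact A.min'_le x hx

theorem leftmost_shiftBy (h : A.Nonempty) (k : ℤ) : leftmost (shiftBy k A) = leftmost A + k := by
  have hmem : leftmost A + k ∈ shiftBy k A := mem_shiftBy.2 (by simpa using leftmost_mem h)
  have hle := leftmost_le (mem_shiftBy.1 (leftmost_mem ⟨_, hmem⟩))
  exact le_antisymm (leftmost_le hmem) (by omega)

/-- The nonempty regions with leftmost site `0`: one representative of each translation class. -/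
def rooted : Set (Finset ℤ) := {A | A.Nonempty ∧ leftmost A = 0}

theorem shiftBy_neg_leftmost_mem_rooted (h : A.Nonempty) : shiftBy (-leftmost A) A ∈ rooted :=
  ⟨h.map, by rw [leftmost_shiftBy h, add_neg_cancel]⟩

theorem subset_Icc_of_mem_rooted (hA : A ∈ rooted) (hr : ∀ i ∈ A, ∀ j ∈ A, j - i < r) :
    A ⊆ Finset.Icc 0 (r : ℤ) := fun x hx => by
  have hlow := leftmost_le hx
  have hhigh := hr _ (leftmost_mem hA.1) x hx
  rw [hA.2] at hlow hhigh
  exact Finset.mem_Icc.2 ⟨hlow, by omega⟩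

theorem finite_rooted_inter_ne_zero (hΦ : opRange Φ ≤ r) : (rooted ∩ {A | Φ A ≠ 0}).Finite :=
  (Finset.finite_toSet (Finset.Icc 0 (r : ℤ)).powerset).subset fun A hA =>
    Finset.mem_powerset.2 (subset_Icc_of_mem_rooted hA.1 (opRange_le_iff.1 hΦ A hA.2))

theorem apply_shiftBy_shiftBy {α : Type*} {f : Finset ℤ → Finset ℤ → α}
    (hf : ∀ A C, f (shift A) (shift C) = f A C) (k : ℤ) (A C : Finset ℤ) :
    f (shiftBy k A) (shiftBy k C) = f A C := by
  induction k using Int.induction_on with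
  | zero => rw [shiftBy_zero, shiftBy_zero]
  | succ k ih => rw [← shift_shiftBy, ← shift_shiftBy, hf, ih]
  | pred k ih => rw [← hf, shift_shiftBy, shift_shiftBy, sub_add_cancel, ih]

-- Mass transport: re-rooting a pair of regions at the leftmost site of the second one.
theorem finsum_rooted_prod_swap {M : Type*} [AddCommMonoid M] {f : Finset ℤ → Finset ℤ → M}
    (hf : ∀ A C, f (shift A) (shift C) = f A C) :
    ∑ᶠ x ∈ rooted ×ˢ {C | C.Nonempty}, f x.1 x.2 =
      ∑ᶠ x ∈ rooted ×ˢ {C | C.Nonempty}, f x.2 x.1 := by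
  let e (x : Finset ℤ × Finset ℤ) : Finset ℤ × Finset ℤ :=
    (shiftBy (-leftmost x.2) x.2, shiftBy (-leftmost x.2) x.1)
  have hmaps : Set.MapsTo e (rooted ×ˢ {C | C.Nonempty}) (rooted ×ˢ {C | C.Nonempty}) :=
    fun x hx => ⟨shiftBy_neg_leftmost_mem_rooted hx.2, hx.1.1.map⟩
  have hinv : Set.LeftInvOn e e (rooted ×ˢ {C | C.Nonempty}) := fun x hx => by
    have hleft : leftmost (shiftBy (-leftmost x.2) x.1) = -leftmost x.2 := by
      rw [leftmost_shiftBy hx.1.1, hx.1.2, zero_add]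
    simp only [e, hleft, neg_neg, shiftBy_shiftBy, neg_add_cancel, shiftBy_zero]
  exact finsum_mem_eq_of_bijOn e (Set.InvOn.bijOn ⟨hinv, hinv⟩ hmaps hmaps) fun x _ =>
    (apply_shiftBy_shiftBy hf (-leftmost x.2) x.1 x.2).symm

theorem IsTranslationInvariant.unshift_eq (h : IsTranslationInvariant Φ) (A : Finset ℤ) :
    unshift (Φ (shift A)) = Φ A := congrFun h A

theorem IsTranslationInvariant.shiftBy_eq_zero_iff (hΦ : IsTranslationInvariant Φ) (k : ℤ)
    (A : Finset ℤ) : Φ (shiftBy k A) = 0 ↔ Φ A = 0 :=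
  (apply_shiftBy_shiftBy (f := fun A _ => Φ A = 0)
    (fun A _ => by rw [← hΦ.unshift_eq A, map_eq_zero_iff _ unshift.injective]) k A A).to_iff

/-- The trace per site `τ(Φ† Ψ)`, an inner product on the translation-invariant local
operators. -/
noncomputable def perSiteInner (Φ Ψ : FormalOp d) : ℂ := ∑ᶠ A ∈ rooted, ntr (star (Φ A) * Ψ A)

/-- The contribution of the pair `(K A, Q C)` to the inner product of `K` and `[H, Q]`. -/
noncomputable def commEntry (K H Q : FormalOp d) (A C : Finset ℤ) : ℂ :=
  ntr (star (K A) * comm H (Pi.single C (Q C)) A)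

theorem isTraceless_single {X : Op d C} (hX : IsTracelessOp X) :
    IsTraceless (Pi.single C X : FormalOp d) := fun A => by
  obtain rfl | hA := eq_or_ne A C
  · rwa [Pi.single_eq_same]
  · rw [Pi.single_eq_of_ne hA]
    exact fun _ _ _ => Finset.sum_const_zero

theorem restrictTo_single (B : Finset ℤ) (X : Op d C) :
    restrictTo (Pi.single C X) B = embedHom B X := by
  rw [restrictTo_eq_sum]
  by_cases hC : C ⊆ B
  · rw [Finset.sum_eq_single_of_mem C (Finset.mem_powerset.2 hC), Pi.single_eq_same]
    exact fun A _ hA => by rw [Pi.single_eq_of_ne hA, map_zero]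
  · rw [embedHom, dif_neg hC]
    refine Finset.sum_eq_zero fun A hA => ?_
    have hne : A ≠ C := fun h => hC (h.symm ▸ Finset.mem_powerset.1 hA :)
    rw [Pi.single_eq_of_ne hne, map_zero]

theorem IsSelfAdj.star_restrictTo (hH : IsSelfAdj H) (B : Finset ℤ) :
    star (restrictTo H B) = restrictTo H B := by
  simp only [restrictTo_eq_sum, star_sum, ← map_star]
  exact Finset.sum_congr rfl fun A _ => congrArg _ (hH A)

open scoped ComplexOrder in
theorem ntr_star_mul_self_nonneg (X : Op d B) : 0 ≤ ntr (star X * X) := by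
  have hcoe : ((d : ℂ) ^ B.card)⁻¹ = (((d : ℝ) ^ B.card)⁻¹ : ℝ) := by push_cast; rfl
  simp only [ntr, LinearMap.smul_apply, hcoe]
  exact mul_nonneg (Complex.zero_le_real.2 (by positivity))
    (Matrix.posSemidef_conjTranspose_mul_self X).trace_nonneg

theorem ntr_star_mul_lie_swap {X Y Z : Op d B} (hZ : star Z = Z) :
    ntr (star X * ⁅Z, Y⁆) = star (ntr (star Y * ⁅Z, X⁆)) := by
  simp only [← ntr_star, Ring.lie_def, star_mul, star_sub, star_star, hZ, mul_sub,
    map_sub, mul_assoc]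
  rw [← mul_assoc (star X) Y Z, ntr_mul_comm (star X * Y) Z]

variable [NeZero d]

theorem comm_single_apply_ne_zero {X : Op d C} (hX : IsTracelessOp X) (hH : opRange H ≤ r)
    (h : comm H (Pi.single C X) A ≠ 0) : C.Nonempty ∧ C ⊆ thicken r A := by
  refine ⟨Finset.nonempty_iff_ne_empty.2 fun hC => ?_, by_contra fun hC => h ?_⟩
  · obtain ⟨E, F, -, hF, hEF, -⟩ := exists_of_comm_apply_ne_zero h
    obtain rfl : F = C := by_contra fun hne => hF (Pi.single_eq_of_ne hne _)
    exact hEF (hC ▸ Finset.disjoint_empty_right E)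
  · rw [comm_apply hH (isTraceless_single hX) subset_rfl, restrictTo_single, embedHom, dif_neg hC,
      NonUnitalStarAlgHom.zero_apply, Ring.lie_def, mul_zero, zero_mul, sub_zero, map_zero]

theorem ntr_star_mul_comm_apply (K : FormalOp d) (hH : opRange H ≤ r) (hQ : IsTraceless Q)
    (hB : thicken r A ⊆ B) :
    ntr (star (K A) * comm H Q A) = ∑ C ∈ B.powerset, commEntry K H Q A C := by
  simp only [commEntry, ← map_sum, ← Finset.mul_sum]
  congr 2
  rw [comm_apply hH hQ hB, restrictTo_eq_sum Q]
  simp only [comm_apply hH (isTraceless_single (hQ _)) hB, restrictTo_single, Ring.lie_def,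
    Finset.mul_sum, Finset.sum_mul, ← Finset.sum_sub_distrib, map_sum]

theorem perSiteInner_comm (hK : opRange K ≤ r₁) (hH : opRange H ≤ r₂) (hQ : IsTraceless Q) :
    perSiteInner K (comm H Q) =
      ∑ᶠ x ∈ rooted ×ˢ {C | C.Nonempty}, commEntry K H Q x.1 x.2 := by
  have hfin := finite_rooted_inter_ne_zero hK
  set B := thicken r₂ (Finset.Icc 0 (r₁ : ℤ))
  have hthicken {A : Finset ℤ} (hA : A ∈ rooted) (hKA : K A ≠ 0) : thicken r₂ A ⊆ B :=
    thicken_subset_thicken (subset_Icc_of_mem_rooted hA (opRange_le_iff.1 hK A hKA))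
  have hentry {A C : Finset ℤ} (h : commEntry K H Q A C ≠ 0) :
      K A ≠ 0 ∧ C.Nonempty ∧ C ⊆ thicken r₂ A := by
    refine ⟨fun h0 => h ?_, comm_single_apply_ne_zero (hQ C) hH fun h0 => h ?_⟩
    · rw [commEntry, h0, star_zero, zero_mul, map_zero]
    · rw [commEntry, h0, mul_zero, map_zero]
  rw [perSiteInner, finsum_mem_eq_sum_of_subset (t := hfin.toFinset),
    finsum_mem_eq_sum_of_subset (t := hfin.toFinset ×ˢ B.powerset.filter Finset.Nonempty),
    Finset.sum_product]
  · refine Finset.sum_congr rfl fun A hA => ?_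
    obtain ⟨hA, hKA⟩ := hfin.mem_toFinset.1 hA
    rw [ntr_star_mul_comm_apply K hH hQ (hthicken hA hKA), Finset.sum_filter_of_ne]
    exact fun C _ h => (hentry h).2.1
  · rintro ⟨A, C⟩ ⟨⟨hA, -⟩, h⟩
    obtain ⟨hKA, hC, hCA⟩ := hentry h
    simpa [hA, hKA, hC] using hCA.trans (hthicken hA hKA)
  · rintro ⟨A, C⟩ h
    obtain ⟨⟨hA, -⟩, -, hC⟩ : (A ∈ rooted ∧ K A ≠ 0) ∧ C ⊆ B ∧ C.Nonempty := by simpa using h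
    exact ⟨hA, hC⟩
  · rintro A ⟨hA, h⟩
    exact hfin.mem_toFinset.2 ⟨hA, fun h0 => h (by simp only [h0, star_zero, zero_mul, map_zero])⟩
  · exact fun A hA => (hfin.mem_toFinset.1 hA).1

theorem commEntry_eq (hH : opRange H ≤ r) (hK : IsTraceless K) (hQ : IsTraceless Q)
    (hA : thicken r A ⊆ W) (C : Finset ℤ) :
    commEntry K H Q A C =
      ntr (star (embedHom W (K A)) * ⁅restrictTo H W, embedHom W (Q C)⁆) := by
  rw [commEntry, comm_apply hH (isTraceless_single (hQ C)) hA, restrictTo_single, ← map_star,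
    (hK A).star.ntr_embedHom_mul (subset_thicken.trans hA)]

theorem commEntry_swap (hH : opRange H ≤ r) (hHs : IsSelfAdj H) (hK : IsTraceless K)
    (hQ : IsTraceless Q) (A C : Finset ℤ) : commEntry K H Q C A = star (commEntry Q H K A C) := by
  rw [commEntry_eq hH hK hQ (thicken_subset_thicken (Finset.subset_union_right (s₁ := A))),
    commEntry_eq hH hQ hK (thicken_subset_thicken (Finset.subset_union_left (s₂ := C))),
    ntr_star_mul_lie_swap (hHs.star_restrictTo _)]

theorem commEntry_shift (hK : IsTranslationInvariant K) (hH : IsTranslationInvariant H)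
    (hQ : IsTranslationInvariant Q) (A C : Finset ℤ) :
    commEntry K H Q (shift A) (shift C) = commEntry K H Q A C := by
  rw [commEntry, ← ntr_unshift, map_mul, unshift_star, hK.unshift_eq, ← translate_apply,
    translate_comm, hH, translate_single, hQ.unshift_eq, commEntry]

theorem perSiteInner_comm_symm (hK : IsLocal r K) (hH : opRange H ≤ r₁) (hQ : IsLocal r₂ Q)
    (hHs : IsSelfAdj H) (hKi : IsTranslationInvariant K) (hHi : IsTranslationInvariant H)
    (hQi : IsTranslationInvariant Q) :
    perSiteInner K (comm H Q) = star (perSiteInner Q (comm H K)) := by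
  rw [perSiteInner_comm hK.opRange_le hH hQ.traceless,
    perSiteInner_comm hQ.opRange_le hH hK.traceless,
    finsum_rooted_prod_swap (commEntry_shift hKi hHi hQi)]
  simp only [commEntry_swap hH hHs hK.traceless hQ.traceless]
  change _ = starAddEquiv _
  simp only [AddEquiv.map_finsum, starAddEquiv_apply]

open scoped ComplexOrder in
theorem ntr_star_mul_self_eq_zero {X : Op d B} : ntr (star X * X) = 0 ↔ X = 0 := by
  have hd : ((d : ℂ) ^ B.card)⁻¹ ≠ 0 :=
    inv_ne_zero (pow_ne_zero _ (Nat.cast_ne_zero.2 (NeZero.ne d)))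
  simp only [ntr, LinearMap.smul_apply, smul_eq_zero_iff_right hd]
  exact Matrix.trace_conjTranspose_mul_self_eq_zero_iff

open scoped ComplexOrder in
theorem eq_zero_of_perSiteInner_self (hΦ : opRange Φ ≤ r) (hΦi : IsTranslationInvariant Φ)
    (h0 : Φ ∅ = 0) (h : perSiteInner Φ Φ = 0) : Φ = 0 := by
  have hfin := finite_rooted_inter_ne_zero hΦ
  rw [perSiteInner, finsum_mem_eq_sum_of_subset (t := hfin.toFinset),
    Finset.sum_eq_zero_iff_of_nonneg fun A _ => ntr_star_mul_self_nonneg _] at h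
  · funext A
    obtain rfl | hA := A.eq_empty_or_nonempty
    · exact h0
    · rw [Pi.zero_apply, ← hΦi.shiftBy_eq_zero_iff (-leftmost A)]
      by_contra hne
      exact hne (ntr_star_mul_self_eq_zero.1 (h _ (hfin.mem_toFinset.2
        ⟨shiftBy_neg_leftmost_mem_rooted hA, hne⟩)))
  · exact fun A hA => hfin.mem_toFinset.2 ⟨hA.1, mt ntr_star_mul_self_eq_zero.2 hA.2⟩
  · exact fun A hA => (hfin.mem_toFinset.1 hA).1

theorem comm_eq_zero_of_comm_comm_eq_zero (hH : IsLocal r₁ H) (hHs : IsSelfAdj H)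
    (hHi : IsTranslationInvariant H) (hQ : IsLocal r₂ Q) (hQi : IsTranslationInvariant Q)
    (h : comm H (comm H Q) = 0) : comm H Q = 0 := by
  have hK : IsLocal (r₁ + r₂) (comm H Q) := hH.comm hQ (Nat.le_succ _)
  have hKi := hHi.comm hQi
  refine eq_zero_of_perSiteInner_self hK.opRange_le hKi (comm_empty H Q) ?_
  rw [perSiteInner_comm_symm hK hH.opRange_le hQ hHs hKi hHi hQi, h]
  simp [perSiteInner]

end TracePerSite

section Families

open scoped Matrix.Norms.Operator

attribute [local instance] LieRing.ofAssociativeRing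

variable {d D : ℕ} {A B : Finset ℤ} {r r₁ r₂ : ℕ} {U : Set (EuclideanSpace ℝ (Fin D))}
  {p w : EuclideanSpace ℝ (Fin D)} {v : EuclideanSpace ℝ (Fin D) → EuclideanSpace ℝ (Fin D)}
  {Φ Ψ b H C Q : EuclideanSpace ℝ (Fin D) → FormalOp d}

theorem contDiffOn_linearMap {f : EuclideanSpace ℝ (Fin D) → Op d A} (L : Op d A →ₗ[ℂ] Op d B)
    (hf : ContDiffOn ℝ ∞ f U) : ContDiffOn ℝ ∞ (fun q => L (f q)) U :=
  (L.restrictScalars ℝ).toContinuousLinearMap.contDiff.comp_contDiffOn hf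

theorem hasLineDerivAt_linearMap {f : EuclideanSpace ℝ (Fin D) → Op d A} {f' : Op d A}
    (L : Op d A →ₗ[ℂ] Op d B) (hf : HasLineDerivAt ℝ f f' p w) :
    HasLineDerivAt ℝ (fun q => L (f q)) (L f') p w :=
  (L.restrictScalars ℝ).toContinuousLinearMap.hasFDerivAt.comp_hasDerivAt 0 hf

theorem hasLineDerivAt_lie {f g : EuclideanSpace ℝ (Fin D) → Op d A} {f' g' : Op d A}
    (hf : HasLineDerivAt ℝ f f' p w) (hg : HasLineDerivAt ℝ g g' p w) :
    HasLineDerivAt ℝ (fun q => ⁅f q, g q⁆) (⁅f', g p⁆ + ⁅f p, g'⁆) p w := by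
  refine ((HasDerivAt.mul hf hg).sub (HasDerivAt.mul hg hf)).congr_deriv ?_
  simp only [zero_smul, add_zero, Ring.lie_def]
  abel

theorem isSmoothOn_iff : IsSmoothOn U Φ ↔ ∀ A, ContDiffOn ℝ ∞ (fun q => Φ q A) U := by
  refine ⟨fun h A => ?_, fun h A s t =>
    (Matrix.entryLinearMap ℝ ℂ s t).toContinuousLinearMap.contDiff.comp_contDiffOn (h A)⟩
  rw [funext fun q => Matrix.matrix_eq_sum_single (Φ q A)]
  refine ContDiffOn.sum fun s _ => ContDiffOn.sum fun t _ => ?_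
  let single : ℂ →L[ℝ] Op d A := (Matrix.singleLinearMap ℝ s t).toContinuousLinearMap
  exact single.contDiff.comp_contDiffOn (h A s t)

theorem IsSmoothOn.hasLineDerivAt (hU : IsOpen U) (hp : p ∈ U) (h : IsSmoothOn U Φ)
    (A : Finset ℤ) : HasLineDerivAt ℝ (fun q => Φ q A) (dirDeriv v Φ p A) p (v p) := by
  have hdiff : HasFDerivAt (fun q => Φ q A) (fderiv ℝ (fun q => Φ q A) p) p :=
    (((isSmoothOn_iff.1 h A).contDiffAt (hU.mem_nhds hp)).differentiableAt (by simp)).hasFDerivAt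
  have hentry : dirDeriv v Φ p A = fderiv ℝ (fun q => Φ q A) p (v p) := by
    ext s t
    let entry : Op d A →L[ℝ] ℂ := (Matrix.entryLinearMap ℝ ℂ s t).toContinuousLinearMap
    exact congrArg (· (v p)) (entry.hasFDerivAt.comp p hdiff).fderiv
  rw [hentry]
  exact hdiff.hasLineDerivAt (v p)

theorem IsSmoothOn.dirDeriv_eq (hU : IsOpen U) (hp : p ∈ U) (h : IsSmoothOn U Φ)
    {f : EuclideanSpace ℝ (Fin D) → Op d A} {f' : Op d A} (hf : ∀ q ∈ U, Φ q A = f q)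
    (hf' : HasLineDerivAt ℝ f f' p (v p)) : dirDeriv v Φ p A = f' :=
  (h.hasLineDerivAt hU hp A).unique <| hf'.congr_of_eventuallyEq <| by
    filter_upwards [hU.mem_nhds hp] with q hq using hf q hq

theorem dirDeriv_congr (hU : IsOpen U) (hp : p ∈ U) (h : ∀ q ∈ U, Φ q A = Ψ q A) :
    dirDeriv v Φ p A = dirDeriv v Ψ p A := by
  ext s t
  have hentry : (fun q => Φ q A s t) =ᶠ[nhds p] fun q => Ψ q A s t := by
    filter_upwards [hU.mem_nhds hp] with q hq using by rw [h q hq]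
  simp only [dirDeriv, Matrix.of_apply, hentry.fderiv_eq]

theorem dirDeriv_eq_zero (hU : IsOpen U) (hp : p ∈ U) (h : ∀ q ∈ U, Φ q A = 0) :
    dirDeriv v Φ p A = 0 := by
  rw [dirDeriv_congr (Ψ := 0) hU hp h]
  ext s t
  simp [dirDeriv]

theorem isTranslationInvariant_dirDeriv (hU : IsOpen U) (hp : p ∈ U)
    (h : ∀ q ∈ U, IsTranslationInvariant (Φ q)) : IsTranslationInvariant (dirDeriv v Φ p) :=
  funext fun A => dirDeriv_congr (Φ := fun q => translate (Φ q)) hU hp fun q hq =>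
    congrFun (h q hq) A

theorem hasLineDerivAt_restrictTo {Φ' : FormalOp d}
    (h : ∀ A, HasLineDerivAt ℝ (fun q => Φ q A) (Φ' A) p w) (B : Finset ℤ) :
    HasLineDerivAt ℝ (fun q => restrictTo (Φ q) B) (restrictTo Φ' B) p w := by
  simp only [restrictTo_eq_sum]
  exact HasDerivAt.fun_sum fun A _ =>
    hasLineDerivAt_linearMap (embedHom (d := d) (A := A) B : Op d A →ₗ[ℂ] Op d B) (h A)

theorem IsSmoothOn.contDiffOn_restrictTo (h : IsSmoothOn U Φ) (B : Finset ℤ) :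
    ContDiffOn ℝ ∞ (fun q => restrictTo (Φ q) B) U := by
  simp only [restrictTo_eq_sum]
  exact ContDiffOn.sum fun A _ =>
    contDiffOn_linearMap (embedHom (d := d) (A := A) B : Op d A →ₗ[ℂ] Op d B)
      (isSmoothOn_iff.1 h A)

/-- Smooth families over `U` of at most `r`-local formal operators; their values outside `U` are
unconstrained. -/
structure IsLocalFamily (U : Set (EuclideanSpace ℝ (Fin D))) (r : ℕ)
    (Φ : EuclideanSpace ℝ (Fin D) → FormalOp d) : Prop where
  smooth : IsSmoothOn U Φ
  isLocal : ∀ p ∈ U, IsLocal r (Φ p)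

/-- Smooth families over `U` of translation-invariant, at most `r`-local formal operators. -/
structure IsInvariantFamily (U : Set (EuclideanSpace ℝ (Fin D))) (r : ℕ)
    (Φ : EuclideanSpace ℝ (Fin D) → FormalOp d) : Prop extends IsLocalFamily U r Φ where
  inv : ∀ p ∈ U, IsTranslationInvariant (Φ p)

theorem IsLocalFamily.mono (h : IsLocalFamily U r₁ Φ) (hr : r₁ ≤ r₂) : IsLocalFamily U r₂ Φ :=
  ⟨h.smooth, fun p hp => (h.isLocal p hp).mono hr⟩

theorem IsLocalFamily.add (hΦ : IsLocalFamily U r Φ) (hΨ : IsLocalFamily U r Ψ) :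
    IsLocalFamily U r fun p => Φ p + Ψ p :=
  ⟨fun A s t => (hΦ.smooth A s t).add (hΨ.smooth A s t),
    fun p hp => (hΦ.isLocal p hp).add (hΨ.isLocal p hp)⟩

theorem IsNearestNeighbor.opRange_le {H : FormalOp d} (h : IsNearestNeighbor H) :
    opRange H ≤ (2 : ℕ) := opRange_le_iff.2 fun A hA i hi j hj => by
  obtain ⟨k, rfl | rfl⟩ := h A hA
  all_goals
    simp only [Finset.mem_singleton, Finset.mem_insert] at hi hj
    omega

theorem IsLocal.boost {H C : FormalOp d} (hH : IsLocal r H) (hC : IsLocal r C) :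
    IsLocal r (boost H C) where
  traceless A := ((hH.traceless A).smul _).add (hC.traceless A)
  opRange_le := opRange_add_le (opRange_le_iff.2 fun A hA =>
    opRange_le_iff.1 hH.opRange_le A (right_ne_zero_of_smul hA)) hC.opRange_le

theorem IsLocalFamily.boost (hH : IsLocalFamily U r H) (hC : IsLocalFamily U r C) :
    IsLocalFamily U r fun p => boost (H p) (C p) :=
  ⟨fun A s t => (contDiffOn_const.mul (hH.smooth A s t)).add (hC.smooth A s t),
    fun p hp => (hH.isLocal p hp).boost (hC.isLocal p hp)⟩

theorem translate_boost_apply {H C : FormalOp d} (hH : IsTranslationInvariant H)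
    (hC : IsTranslationInvariant C) (hA : A.Nonempty) :
    translate (boost H C) A = (boost H C + H) A := by
  have hleft : leftmost (shift A) = leftmost A + 1 := leftmost_shiftBy hA 1
  rw [translate_apply, boost, map_add, map_smul, hH.unshift_eq, hC.unshift_eq, hleft,
    Pi.add_apply, boost]
  push_cast
  rw [add_smul, one_smul, add_right_comm]

/-- The derivation `[b, ·] + v · ∇`, which for the boost `b = B_H` maps `Q⁽ⁿ⁾` to `Q⁽ⁿ⁺¹⁾`. -/
noncomputable def covDeriv (v : EuclideanSpace ℝ (Fin D) → EuclideanSpace ℝ (Fin D))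
    (b Φ : EuclideanSpace ℝ (Fin D) → FormalOp d) : EuclideanSpace ℝ (Fin D) → FormalOp d :=
  fun p => comm (b p) (Φ p) + dirDeriv v Φ p

theorem covDeriv_eq_zero (hU : IsOpen U) (hp : p ∈ U) (h : ∀ q ∈ U, Φ q = 0) :
    covDeriv v b Φ p = 0 := by
  rw [covDeriv, h p hp, comm_zero_right, zero_add]
  exact funext fun A => dirDeriv_eq_zero hU hp fun q hq => congrFun (h q hq) A

theorem charge_add_three (n : ℕ) : charge v H C (n + 3) =
    covDeriv v (fun p => boost (H p) (C p)) (charge v H C (n + 2)) := rfl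

variable [NeZero d]

theorem IsLocalFamily.dirDeriv (hU : IsOpen U) (hv : ContDiffOn ℝ ∞ v U)
    (h : IsLocalFamily U r Φ) : IsLocalFamily U r (dirDeriv v Φ) where
  smooth A s t := ((h.smooth A s t).fderiv_of_isOpen hU (m := ∞) (by simp)).clm_apply hv
  isLocal p hp :=
    { traceless := fun A => by
        rw [h.smooth.dirDeriv_eq hU hp
          (fun q hq => (((h.isLocal q hq).traceless A).componentₗ_self).symm)
          (hasLineDerivAt_linearMap (componentₗ A) (h.smooth.hasLineDerivAt hU hp A))]
        exact isTracelessOp_componentₗ subset_rfl _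
      opRange_le := opRange_le_iff.2 fun A hA => by
        obtain ⟨q, hq, hqA⟩ : ∃ q ∈ U, Φ q A ≠ 0 := by
          by_contra! h0
          exact hA (dirDeriv_eq_zero hU hp h0)
        exact opRange_le_iff.1 (h.isLocal q hq).opRange_le A hqA }

theorem IsLocalFamily.comm (hΦ : IsLocalFamily U r₁ Φ) (hΨ : IsLocalFamily U r₂ Ψ)
    (hr : r₁ + r₂ ≤ r + 1) : IsLocalFamily U r fun p => comm (Φ p) (Ψ p) where
  smooth := isSmoothOn_iff.2 fun A => by
    have hΦA := hΦ.smooth.contDiffOn_restrictTo (thicken r₁ A)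
    have hΨA := hΨ.smooth.contDiffOn_restrictTo (thicken r₁ A)
    refine (contDiffOn_linearMap (componentₗ A) ((hΦA.mul hΨA).sub (hΨA.mul hΦA))).congr ?_
    exact fun q hq =>
      comm_apply (hΦ.isLocal q hq).opRange_le (hΨ.isLocal q hq).traceless subset_rfl
  isLocal p hp := (hΦ.isLocal p hp).comm (hΨ.isLocal p hp) hr

theorem dirDeriv_comm (hU : IsOpen U) (hv : ContDiffOn ℝ ∞ v U) (hp : p ∈ U)
    (hΦ : IsLocalFamily U r₁ Φ) (hΨ : IsLocalFamily U r₂ Ψ) :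
    dirDeriv v (fun q => comm (Φ q) (Ψ q)) p =
      comm (dirDeriv v Φ p) (Ψ p) + comm (Φ p) (dirDeriv v Ψ p) := by
  funext A
  rw [Pi.add_apply,
    comm_apply ((hΦ.dirDeriv hU hv).isLocal p hp).opRange_le (hΨ.isLocal p hp).traceless
      subset_rfl,
    comm_apply (hΦ.isLocal p hp).opRange_le ((hΨ.dirDeriv hU hv).isLocal p hp).traceless
      subset_rfl, ← map_add]
  exact (hΦ.comm hΨ (Nat.le_succ _)).smooth.dirDeriv_eq hU hp
    (fun q hq => comm_apply (hΦ.isLocal q hq).opRange_le (hΨ.isLocal q hq).traceless subset_rfl) <|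
    hasLineDerivAt_linearMap (componentₗ A) <| hasLineDerivAt_lie
      (hasLineDerivAt_restrictTo (hΦ.smooth.hasLineDerivAt hU hp) (thicken r₁ A))
      (hasLineDerivAt_restrictTo (hΨ.smooth.hasLineDerivAt hU hp) (thicken r₁ A))

theorem IsLocalFamily.covDeriv {k : ℕ} (hU : IsOpen U) (hv : ContDiffOn ℝ ∞ v U)
    (hb : IsLocalFamily U (k + 1) b) (hΦ : IsLocalFamily U r Φ) :
    IsLocalFamily U (r + k) (covDeriv v b Φ) :=
  (hb.comm hΦ (by omega)).add ((hΦ.dirDeriv hU hv).mono (Nat.le_add_right r k))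

theorem covDeriv_comm (hU : IsOpen U) (hv : ContDiffOn ℝ ∞ v U) (hp : p ∈ U)
    (hb : IsLocalFamily U r b) (hΦ : IsLocalFamily U r₁ Φ) (hΨ : IsLocalFamily U r₂ Ψ) :
    covDeriv v b (fun q => comm (Φ q) (Ψ q)) p =
      comm (covDeriv v b Φ p) (Ψ p) + comm (Φ p) (covDeriv v b Ψ p) := by
  have hdΦ := (hΦ.dirDeriv hU hv).isLocal p hp
  have hdΨ := (hΨ.dirDeriv hU hv).isLocal p hp
  have hbΦ := (hb.isLocal p hp).comm (hΦ.isLocal p hp) (Nat.le_succ _)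
  simp only [covDeriv]
  rw [comm_jacobi (hb.isLocal p hp) (hΦ.isLocal p hp) (hΨ.isLocal p hp),
    dirDeriv_comm hU hv hp hΦ hΨ,
    comm_add_left hbΦ.opRange_le (hdΦ.mono (Nat.le_add_left r₁ r)).opRange_le
      (hΨ.isLocal p hp).traceless,
    comm_add_right (hΦ.isLocal p hp).opRange_le (isTraceless_comm _ _) hdΨ.traceless,
    add_add_add_comm]

theorem comm_covDeriv_add_comm_covDeriv (hU : IsOpen U) (hv : ContDiffOn ℝ ∞ v U) (hp : p ∈ U)
    (hb : IsLocalFamily U r b) (hΦ : IsLocalFamily U r₁ Φ) (hΨ : IsLocalFamily U r₂ Ψ)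
    (h : ∀ q ∈ U, comm (Φ q) (Ψ q) = 0) :
    comm (covDeriv v b Φ p) (Ψ p) + comm (Φ p) (covDeriv v b Ψ p) = 0 := by
  rw [← covDeriv_comm hU hv hp hb hΦ hΨ, covDeriv_eq_zero hU hp h]

theorem isTranslationInvariant_covDeriv_boost (hU : IsOpen U) (hp : p ∈ U)
    (hH : IsInvariantFamily U r H) (hC : IsInvariantFamily U r C) (hQ : IsInvariantFamily U r₁ Q)
    (hHQ : comm (H p) (Q p) = 0) :
    IsTranslationInvariant (covDeriv v (fun q => boost (H q) (C q)) Q p) := by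
  have hHp := hH.isLocal p hp
  have hcomm : IsTranslationInvariant (comm (boost (H p) (C p)) (Q p)) := by
    rw [IsTranslationInvariant, translate_comm, hQ.inv p hp,
      comm_congr_left fun A => translate_boost_apply (hH.inv p hp) (hC.inv p hp),
      comm_add_left (hHp.boost (hC.isLocal p hp)).opRange_le hHp.opRange_le
        (hQ.isLocal p hp).traceless, hHQ, add_zero]
  rw [IsTranslationInvariant, covDeriv, translate_add, hcomm,
    isTranslationInvariant_dirDeriv hU hp hQ.inv]

theorem comm_covDeriv_eq_zero (hU : IsOpen U) (hv : ContDiffOn ℝ ∞ v U) (hp : p ∈ U) {k : ℕ}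
    (hb : IsLocalFamily U (k + 1) b) (hH : IsInvariantFamily U r H) (hHs : IsSelfAdj (H p))
    (hQ : IsLocalFamily U r₁ Q) (hδQ : IsTranslationInvariant (covDeriv v b Q p))
    (hHδH : comm (H p) (covDeriv v b H p) = 0) (hHQ : ∀ q ∈ U, comm (H q) (Q q) = 0) :
    comm (H p) (covDeriv v b Q p) = 0 := by
  have hHp := hH.isLocal p hp
  refine comm_eq_zero_of_comm_comm_eq_zero hHp hHs (hH.inv p hp)
    ((hb.covDeriv hU hv hQ).isLocal p hp) hδQ ?_
  have hjacobi : comm (H p) (comm (covDeriv v b H p) (Q p)) = 0 := by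
    rw [comm_jacobi hHp ((hb.covDeriv hU hv hH.toIsLocalFamily).isLocal p hp) (hQ.isLocal p hp),
      hHδH, hHQ p hp, comm_zero_left, comm_zero_right, add_zero]
  calc comm (H p) (comm (H p) (covDeriv v b Q p))
      = comm (H p) (comm (covDeriv v b H p) (Q p) + comm (H p) (covDeriv v b Q p)) := by
        rw [comm_add_right hHp.opRange_le (isTraceless_comm _ _) (isTraceless_comm _ _), hjacobi,
          zero_add]
    _ = 0 := by
        rw [comm_covDeriv_add_comm_covDeriv hU hv hp hb hH.toIsLocalFamily hQ hHQ,
          comm_zero_right]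

theorem isInvariantFamily_charge {k : ℕ} (hU : IsOpen U) (hv : ContDiffOn ℝ ∞ v U)
    (hH : IsInvariantFamily U (k + 1) H) (hHs : ∀ p ∈ U, IsSelfAdj (H p))
    (hC : IsInvariantFamily U (k + 1) C) (hQ₃ : ∀ p ∈ U, comm (H p) (charge v H C 3 p) = 0)
    (n : ℕ) : IsInvariantFamily U ((n + 1) * k + 1) (charge v H C (n + 2)) ∧
      ∀ p ∈ U, comm (H p) (charge v H C (n + 2) p) = 0 := by
  have hb := hH.toIsLocalFamily.boost hC.toIsLocalFamily
  induction n with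
  | zero => exact ⟨by simpa [charge] using hH, fun p _ => comm_self (H p)⟩
  | succ n ih =>
    obtain ⟨hQ, hHQ⟩ := ih
    have hinv (p) (hp : p ∈ U) : IsTranslationInvariant
        (covDeriv v (fun q => boost (H q) (C q)) (charge v H C (n + 2)) p) :=
      isTranslationInvariant_covDeriv_boost hU hp hH hC hQ (hHQ p hp)
    rw [charge_add_three]
    refine ⟨⟨?_, hinv⟩, fun p hp => ?_⟩
    · exact (hb.covDeriv hU hv hQ.toIsLocalFamily).mono (by linarith)
    · exact comm_covDeriv_eq_zero hU hv hp hb hH (hHs p hp) hQ.toIsLocalFamily (hinv p hp)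
        (hQ₃ p hp) hHQ

theorem comm_charge_charge (hU : IsOpen U) (hv : ContDiffOn ℝ ∞ v U)
    (hb : IsLocalFamily U r fun p => boost (H p) (C p))
    {range : ℕ → ℕ} (hQ : ∀ n, IsLocalFamily U (range n) (charge v H C (n + 2)))
    (hHQ : ∀ n, ∀ p ∈ U, comm (H p) (charge v H C (n + 2) p) = 0)
    (m n : ℕ) (hp : p ∈ U) : comm (charge v H C (m + 2) p) (charge v H C (n + 2) p) = 0 := by
  induction m generalizing n p with
  | zero => exact hHQ n p hp
  | succ m ih =>
    have hleibniz := comm_covDeriv_add_comm_covDeriv hU hv hp hb (hQ m) (hQ n) fun q => ih n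
    rwa [← charge_add_three, ← charge_add_three, ih (n + 1) hp, add_zero] at hleibniz

end Families

end SpinChain

theorem theorem3_general {d D k : ℕ} [NeZero d] {U : Set (EuclideanSpace ℝ (Fin D))}
    (hU : IsOpen U) {v : EuclideanSpace ℝ (Fin D) → EuclideanSpace ℝ (Fin D)}
    (hv : ContDiffOn ℝ ∞ v U) {H C : EuclideanSpace ℝ (Fin D) → SpinChain.FormalOp d}
    (hH : SpinChain.IsInvariantFamily U (k + 1) H) (hHs : ∀ p ∈ U, SpinChain.IsSelfAdj (H p))
    (hC : SpinChain.IsInvariantFamily U (k + 1) C)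
    (hQ₃ : ∀ p ∈ U, SpinChain.IsConserved (H p) (SpinChain.charge v H C 3 p)) :
    (∀ n, SpinChain.IsInvariantFamily U ((n + 1) * k + 1) (SpinChain.charge v H C (n + 2))) ∧
      ∀ m n, ∀ p ∈ U,
        SpinChain.comm (SpinChain.charge v H C (m + 2) p) (SpinChain.charge v H C (n + 2) p) = 0 :=
  have hQ := SpinChain.isInvariantFamily_charge hU hv hH hHs hC hQ₃
  ⟨fun n => (hQ n).1, fun m n _ hp => SpinChain.comm_charge_charge hU hv
    (hH.toIsLocalFamily.boost hC.toIsLocalFamily) (fun n => (hQ n).1.toIsLocalFamily)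
    (fun n => (hQ n).2) m n hp⟩

theorem theorem3 (d D : ℕ) (hd : 0 < d)
    (U : Set (EuclideanSpace ℝ (Fin D))) (hU : IsOpen U)
    (v : EuclideanSpace ℝ (Fin D) → EuclideanSpace ℝ (Fin D)) (hv : ContDiffOn ℝ ∞ v U)
    (H C : EuclideanSpace ℝ (Fin D) → SpinChain.FormalOp d)
    -- the Hamiltonians `H(p) = ∑ᵢ h²ᵢ(p) + ∑ᵢ h¹ᵢ(p)`
    (hH_traceless : ∀ p ∈ U, SpinChain.IsTraceless (H p))
    (hH_nn : ∀ p ∈ U, SpinChain.IsNearestNeighbor (H p))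
    (hH_sa : ∀ p ∈ U, SpinChain.IsSelfAdj (H p))
    (hH_inv : ∀ p ∈ U, SpinChain.IsTranslationInvariant (H p))
    (hH_smooth : SpinChain.IsSmoothOn U H)
    -- the one-local operators `C(p) = ∑ᵢ cᵢ(p)` in the boost operators
    (hC_traceless : ∀ p ∈ U, SpinChain.IsTraceless (C p))
    (hC_local : ∀ p ∈ U, SpinChain.opRange (C p) ≤ 1)
    (hC_inv : ∀ p ∈ U, SpinChain.IsTranslationInvariant (C p))
    (hC_smooth : SpinChain.IsSmoothOn U C)
    -- the generalized Reshetikhin condition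
    (hQ3 : ∀ p ∈ U, SpinChain.IsConserved (H p) (SpinChain.charge v H C 3 p)) :
    -- the `Q⁽ⁿ⁾` are well-defined smooth families of at most `n`-local formal operators
    (∀ n : ℕ, 2 ≤ n → SpinChain.IsSmoothOn U (SpinChain.charge v H C n) ∧
      ∀ p ∈ U, SpinChain.IsTraceless (SpinChain.charge v H C n p) ∧
        SpinChain.opRange (SpinChain.charge v H C n p) ≤ (n : ℕ∞)) ∧
    -- they are translation-invariant conserved quantities
    (∀ n : ℕ, 2 ≤ n → ∀ p ∈ U,
      SpinChain.IsTranslationInvariant (SpinChain.charge v H C n p) ∧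
        SpinChain.IsConserved (H p) (SpinChain.charge v H C n p)) ∧
    -- and commute with each other
    (∀ m n : ℕ, 2 ≤ m → 2 ≤ n → ∀ p ∈ U,
      SpinChain.comm (SpinChain.charge v H C m p) (SpinChain.charge v H C n p) = 0) := by
  have : NeZero d := ⟨hd.ne'⟩
  have hH : SpinChain.IsInvariantFamily U 2 H :=
    ⟨⟨hH_smooth, fun p hp => ⟨hH_traceless p hp, (hH_nn p hp).opRange_le⟩⟩, hH_inv⟩
  have hC : SpinChain.IsInvariantFamily U 2 C :=
    ⟨⟨hC_smooth, fun p hp => ⟨hC_traceless p hp, (hC_local p hp).trans one_le_two⟩⟩, hC_inv⟩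
  obtain ⟨hQ, hcomm⟩ := theorem3_general hU hv hH hH_sa hC hQ3
  refine ⟨fun n hn => ?_, fun n hn p hp => ?_, fun m n hm hn p hp => ?_⟩
  · obtain ⟨n, rfl⟩ := Nat.exists_eq_add_of_le' hn
    refine ⟨(hQ n).smooth, fun p hp => ⟨((hQ n).isLocal p hp).traceless, ?_⟩⟩
    simpa only [mul_one] using ((hQ n).isLocal p hp).opRange_le
  · obtain ⟨n, rfl⟩ := Nat.exists_eq_add_of_le' hn
    exact ⟨(hQ n).inv p hp, hcomm 0 n p hp⟩
  · obtain ⟨m, rfl⟩ := Nat.exists_eq_add_of_le' hm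
    obtain ⟨n, rfl⟩ := Nat.exists_eq_add_of_le' hn
    exact hcomm m n p hp
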